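/- Let $t\in\mathbb N_0$. For each moment $\tau\in[t]$ let two finitely supported functions $f_1^{(\tau)},f_2^{(\tau)}:\mathbb Q\to\mathbb N_0$ be given, prescribing the number of points on each horizontal line $\{y=c\}$, respectively on each vertical line $\{x=c\}$ ($c\in\mathbb Q$), and let $G^{(\tau)}=\operatorname{supp} f_2^{(\tau)}\times\operatorname{supp} f_1^{(\tau)}\subset\mathbb Q^2$ be the grid of candidate points. Let further windows $\emptyset\ne W_i^{(\tau)}\subseteq G^{(\tau)}$ ($i\in[l_\tau]$, $l_\tau\in\mathbb N_0$) be given, together with pairs $(\sim_i^{(\tau)},k_i^{(\tau)})\in\{\le,=,\ge\}\times\mathbb N_0$. The problem *Tomography under Window Constraints* is: find sets $F^{(\tau)}\subseteq G^{(\tau)}$, $\tau\in[t]$, such that for all $\tau\in[t]$ $$|F^{(\tau)}\cap\{y=c\}|=f_1^{(\tau)}(c)\ \ (c\in \operatorname{supp} f_1^{(\tau)}),\qquad |F^{(\tau)}\cap\{x=c\}|=f_2^{(\tau)}(c)\ \ (c\in \operatorname{supp} f_2^{(\tau)}),\qquad |F^{(\tau)}\cap W_i^{(\tau)}|\sim_i^{(\tau)}k_i^{(\tau)}\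 \ (i\in[l_\tau]),$$ or report that no such sets exist. The functions are given by the list of their nonzero values, the windows by the list of their points, and all numbers are encoded in binary. **Theorem.** Tomography under Window Constraints is solvable in polynomial time (by a deterministic Turing machine, in the binary length of the input) if the instances are restricted to satisfy the following two properties: 1. for all $\tau\in[t]$ and $i\in[l_\tau]$, the window $W_i^{(\tau)}$ lies in a single horizontal line $\{y=c\}$ or in a single vertical line $\{x=c\}$, for some $c\in\mathbb Q$; 2. for all $\tau\in[t]$ and $i\ne j\in[l_\tau]$, $W_i^{(\tau)}\cap W_j^{(\tau)}=\emptyset$. -/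

import Mathlib

/-! ## Instances of Tomography under Window Constraints

Two coordinate directions in the plane, points with rational coordinates. All data are finite
tables, in the form in which they are handed to a machine. -/

namespace WindowTomography

/-- The three possible comparison signs of a window constraint. -/
inductive Rel
  | le | eq | ge

/-- `r.Holds a k` says that `a ∼ k`, where `∼` is the sign `r`. -/
def Rel.Holds : Rel → ℕ → ℕ → Prop
  | .le, a, k => a ≤ k
  | .eq, a, k => a = k
  | .ge, a, k => k ≤ a

/-- A window (a finite set of points, listed in some order) with its constraint `(∼, k)`. -/
structure Window where
  points : List (ℚ × ℚ)
  rel : Rel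
  bound : ℕ

/-- The data for one moment in time. X-ray data are given by listing, for each direction, the
lines on which the measured function is nonzero, together with the values there: `(c, b)` in
`rows` means that the line `y = c` carries the value `b`, and `(c, b)` in `cols` means that the
line `x = c` carries the value `b`. -/
structure Slice where
  rows : List (ℚ × ℕ)
  cols : List (ℚ × ℕ)
  windows : List Window

/-- The grid of candidate points: the points that lie both on a line of the support of the first
X-ray and on a line of the support of the second one. -/
def Slice.grid (S : Slice) : Finset (ℚ × ℚ) :=
  (S.cols.map Prod.fst).toFinset ×ˢ (S.rows.map Prod.fst).toFinset

/-- A table lists every line of the support exactly once, with its (nonzero) value. -/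
def IsSupportTable (l : List (ℚ × ℕ)) : Prop :=
  (l.map Prod.fst).Nodup ∧ ∀ e ∈ l, 0 < e.2

/-- The data are well-formed: the X-rays are given by support tables and every window is a
nonempty subset of the grid. -/
def Slice.WellFormed (S : Slice) : Prop :=
  IsSupportTable S.rows ∧ IsSupportTable S.cols ∧
    ∀ w ∈ S.windows, w.points ≠ [] ∧ w.points.Nodup ∧ ∀ p ∈ w.points, p ∈ S.grid

/-- Every window lies in one horizontal or in one vertical line. -/
def Slice.WindowsInLines (S : Slice) : Prop :=
  ∀ w ∈ S.windows, (∃ c : ℚ, ∀ p ∈ w.points, p.2 = c) ∨ (∃ c : ℚ, ∀ p ∈ w.points, p.1 = c)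

/-- Any two different windows (of the same moment in time) are disjoint. -/
def Slice.WindowsDisjoint (S : Slice) : Prop :=
  S.windows.Pairwise fun v w => List.Disjoint v.points w.points

/-- `F` is a solution for one moment in time: a subset of the grid (that is, a 0/1-vector indexed
by the grid) that has the prescribed number of points on each horizontal and each vertical line
of the support and satisfies all window constraints. -/
def Slice.IsSolution (S : Slice) (F : Finset (ℚ × ℚ)) : Prop :=
  F ⊆ S.grid ∧
  (∀ e ∈ S.rows, (F.filter fun p => p.2 = e.1).card = e.2) ∧
  (∀ e ∈ S.cols, (F.filter fun p => p.1 = e.1).card = e.2) ∧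
  (∀ w ∈ S.windows, w.rel.Holds (F ∩ w.points.toFinset).card w.bound)

/-- An instance: the data for the moments `1, …, t`, where `t` is the length of the list. -/
abbrev Instance := List Slice

/-- The instances with well-formed data whose windows are pairwise disjoint at each moment in
time, each lying in one horizontal or one vertical line. -/
def Instance.IsOrthogonal (I : Instance) : Prop :=
  ∀ S ∈ I, S.WellFormed ∧ S.WindowsInLines ∧ S.WindowsDisjoint

/-- A solution of an instance: one point set for each moment in time, each one listed without
repetitions in some order. -/
def Instance.IsSolution (I : Instance) (L : List (List (ℚ × ℚ))) : Prop :=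
  List.Forall₂ (fun S F => F.Nodup ∧ Slice.IsSolution S F.toFinset) I L

/-! ## Encoding in binary -/

/-- The finite alphabet. -/
inductive Sym
  | bit (b : Bool)
  | minus | endNum | item | close
  | le | eq | ge
  deriving DecidableEq, Fintype

/-- A natural number is encoded by its binary digits, least significant first. -/
def encNat (n : ℕ) : List Sym :=
  n.bits.map Sym.bit ++ [Sym.endNum]

/-- A rational number is encoded by sign, numerator and denominator in lowest terms. -/
def encRat (q : ℚ) : List Sym :=
  (if q < 0 then [Sym.minus] else []) ++ encNat q.num.natAbs ++ encNat q.den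

/-- A pair is encoded by its components, one after the other. -/
def encPair {α β : Type} (ea : α → List Sym) (eb : β → List Sym) (x : α × β) : List Sym :=
  ea x.1 ++ eb x.2

/-- A list is encoded by its entries, each preceded by `item`, and a final `close`. -/
def encList {α : Type} (ea : α → List Sym) (l : List α) : List Sym :=
  l.flatMap (fun a => Sym.item :: ea a) ++ [Sym.close]

def encRel : Rel → List Sym
  | .le => [Sym.le]
  | .eq => [Sym.eq]
  | .ge => [Sym.ge]

def encWindow (w : Window) : List Sym :=
  encList (encPair encRat encRat) w.points ++ encRel w.rel ++ encNat w.bound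

def encSlice (S : Slice) : List Sym :=
  encList (encPair encRat encNat) S.rows ++ encList (encPair encRat encNat) S.cols ++
    encList encWindow S.windows

def encInstance (I : Instance) : List Sym :=
  encList encSlice I

def encSolution (L : List (List (ℚ × ℚ))) : List Sym :=
  encList (encList (encPair encRat encRat)) L

/-- An answer is either "there is no solution" or a solution. -/
def encAnswer {β : Type} (eb : β → List Sym) : Option β → List Sym
  | none => [Sym.close]
  | some b => Sym.item :: eb b

/-! The encodings lose no information. -/

/-- Codes can be read off uniquely from the front of a word. -/
def Readable {α : Type} (e : α → List Sym) : Prop :=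
  ∀ a b u v, e a ++ u = e b ++ v → a = b ∧ u = v

theorem readable_encNat : Readable encNat := by
  intro a b u v h
  have key : ∀ (l m : List Bool) (u v : List Sym),
      l.map Sym.bit ++ Sym.endNum :: u = m.map Sym.bit ++ Sym.endNum :: v → l = m ∧ u = v := by
    intro l
    induction l with
    | nil => intro m u v h; cases m <;> simp_all
    | cons x l ih =>
      intro m u v h
      cases m with
      | nil => simp at h
      | cons y m =>
        simp only [List.map_cons, List.cons_append, List.cons.injEq, Sym.bit.injEq] at h
        obtain ⟨h1, h2⟩ := ih m u v h.2
        exact ⟨by rw [h.1, h1], h2⟩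
  obtain ⟨h1, h2⟩ := key a.bits b.bits u v (by simpa [encNat] using h)
  refine ⟨?_, h2⟩
  have h3 : Nat.digits 2 a = Nat.digits 2 b := by
    rw [Nat.digits_two_eq_bits, Nat.digits_two_eq_bits, h1]
  exact Nat.digits.injective 2 h3

theorem encNat_ne_minus (n : ℕ) (u v : List Sym) : encNat n ++ u ≠ Sym.minus :: v := by
  cases h : n.bits <;> simp [encNat, h]

theorem readable_encRat : Readable encRat := by
  intro a b u v h
  have key : ∀ u v : List Sym, encNat a.num.natAbs ++ (encNat a.den ++ u) =
      encNat b.num.natAbs ++ (encNat b.den ++ v) → (a < 0 ↔ b < 0) → a = b ∧ u = v := by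
    intro u v h hs
    obtain ⟨h1, h⟩ := readable_encNat _ _ _ _ h
    obtain ⟨h2, h⟩ := readable_encNat _ _ _ _ h
    refine ⟨Rat.ext ?_ h2, h⟩
    rw [← Rat.num_neg, ← Rat.num_neg] at hs
    omega
  by_cases ha : a < 0 <;> by_cases hb : b < 0
  · exact key u v (by simpa [encRat, ha, hb] using h) (by simp [ha, hb])
  · exact absurd (by simpa [encRat, ha, hb] using h.symm) (encNat_ne_minus _ _ _)
  · exact absurd (by simpa [encRat, ha, hb] using h) (encNat_ne_minus _ _ _)
  · exact key u v (by simpa [encRat, ha, hb] using h) (by simp [ha, hb])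

theorem Readable.pair {α β : Type} {ea : α → List Sym} {eb : β → List Sym}
    (ha : Readable ea) (hb : Readable eb) : Readable (encPair ea eb) := by
  intro x y u v h
  simp only [encPair, List.append_assoc] at h
  obtain ⟨h1, h⟩ := ha _ _ _ _ h
  obtain ⟨h2, h⟩ := hb _ _ _ _ h
  exact ⟨Prod.ext h1 h2, h⟩

theorem Readable.list {α : Type} {ea : α → List Sym} (ha : Readable ea) :
    Readable (encList ea) := by
  intro l
  induction l with
  | nil => intro m u v h; cases m <;> simp_all [encList]
  | cons x l ih =>
    intro m u v h
    cases m with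
    | nil => simp [encList] at h
    | cons y m =>
      simp only [encList, List.flatMap_cons, List.cons_append, List.append_assoc,
        List.cons.injEq, true_and] at h
      obtain ⟨h1, h⟩ := ha _ _ _ _ h
      obtain ⟨h2, h⟩ := ih m u v (by simpa [encList] using h)
      exact ⟨by rw [h1, h2], h⟩

theorem readable_encRel : Readable encRel := by
  intro a b u v h
  cases a <;> cases b <;> simp_all [encRel]

theorem readable_encWindow : Readable encWindow := by
  rintro ⟨p, r, k⟩ ⟨p', r', k'⟩ u v h
  simp only [encWindow, List.append_assoc] at h
  obtain ⟨h1, h⟩ := (readable_encRat.pair readable_encRat).list _ _ _ _ h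
  obtain ⟨h2, h⟩ := readable_encRel _ _ _ _ h
  obtain ⟨h3, h⟩ := readable_encNat _ _ _ _ h
  exact ⟨by simp_all, h⟩

theorem readable_encSlice : Readable encSlice := by
  rintro ⟨p, r, k⟩ ⟨p', r', k'⟩ u v h
  simp only [encSlice, List.append_assoc] at h
  obtain ⟨h4, h⟩ := (readable_encRat.pair readable_encNat).list _ _ _ _ h
  obtain ⟨h5, h⟩ := (readable_encRat.pair readable_encNat).list _ _ _ _ h
  obtain ⟨h6, h⟩ := readable_encWindow.list _ _ _ _ h
  exact ⟨by simp_all, h⟩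

theorem encInstance_injective : Function.Injective encInstance := fun a b h =>
  (readable_encSlice.list a b [] [] (by simpa [encInstance] using h)).1

theorem encAnswer_injective : Function.Injective (encAnswer encSolution) := by
  intro a b h
  cases a <;> cases b <;> simp [encAnswer] at h ⊢
  exact ((readable_encRat.pair readable_encRat).list.list _ _ [] []
    (by simpa [encSolution] using h)).1

/-! ## Polynomial-time solvability -/

/-- The search problem "given `a`, find `b` with `R a b` or report that there is none", restricted
to the instances `a` with `P a`, is solvable in polynomial time: some Turing machine with finitely
many stacks, all over finite alphabets, computes a correct answer from the code of `a` within a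
number of steps that is bounded by a polynomial in the length of that code. -/
def SolvableInPolyTime {α β : Type} (ea : α → List Sym) (eb : β → List Sym)
    (P : α → Prop) (R : α → β → Prop) : Prop :=
  ∃ f : {a : α // P a} → Option β,
    (∀ a b, f a = some b → R a.1 b) ∧
    (∀ a, f a = none → ¬ ∃ b, R a.1 b) ∧
    ∃ M : Turing.TM2ComputableInPolyTime (fun a : {a : α // P a} => ea a.1) (encAnswer eb) f,
      ∀ k, Finite (M.tm.Γ k)

end WindowTomography

/-!
# Polynomial-time tomography under window constraints

The problem splits into independent problems for the moments in time, and for one moment it is a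
feasibility problem for integral circulations. The network has a root, a node for each line of the
support of an X-ray, and a node for each window. Flow runs from the root to the rows, from a row to
the horizontal windows in it, from there along the arc of a point to a vertical window or a column,
and from the columns back to the root. A point outside all horizontal windows is joined directly to
its row, and similarly for columns; disjointness of the windows makes this unambiguous. Since the
rows, columns and windows form a tree below the root, a circulation is determined by the set of
points whose arcs carry flow, and the flow along the arc of a line or of a window is the number of
these points on the line or in the window (`IsAdapted.isFeasible`, `IsAdapted.le_countP`). All
bounds are cut off just above the number of candidate points, written in unary, and turned into
parallel arcs of capacity one, some of which are forced to carry flow.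

The algorithm starts with the zero flow and sends flow around residual cycles through forced arcs
without flow. Each such cycle decreases the number of violated arcs, and if there is none through a
given violated arc, then the nodes from which its tail can be reached form a cut that no circulation
can cross as required (`reaches_of_isFeasible`). The number of rounds is at most the number of arcs
(`optimize_spec`).

For the running time, programs in a small structured language for three stacks are compiled into
stack machines (`Exec.simulate`, `Cmd.computable`). All data are kept on one stack as
self-delimiting words, the code of a pair being the concatenation of the codes of its components, so
that the given codes of instances and answers can be worked on as they are. A function is
`PolyTime` if a program replaces the code of its argument on top of the stack by the code of its
value in polynomially many steps. These functions are closed under composition, pairing, case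
distinction and iteration along a list with polynomially bounded intermediate results
(`PolyTime.foldl_of_size`), and contain equality tests, which suffices for all parts of the
algorithm (`PolyTime.instance_solve`).
-/

namespace WindowTomography

/-! ### A structured language for three stacks -/

/-- The names of the three stacks. -/
inductive Reg
  | a | b | c
  deriving DecidableEq

instance : Fintype Reg := ⟨{.a, .b, .c}, fun k => by cases k <;> simp⟩

/-- The contents of the three stacks. -/
abbrev Store := List Sym × List Sym × List Sym

/-- The content of one stack. -/
def Store.get (s : Store) : Reg → List Sym
  | .a => s.1
  | .b => s.2.1
  | .c => s.2.2

/-- The store after the content of one stack has been replaced. -/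
def Store.set (s : Store) (k : Reg) (l : List Sym) : Store :=
  match k with
  | .a => (l, s.2.1, s.2.2)
  | .b => (s.1, l, s.2.2)
  | .c => (s.1, s.2.1, l)

/-- Structured programs. `pop k f` takes the top symbol `x` off the stack `k` (`none` if there is
none) and goes on with `f x`; `loop k p d` repeats `d` while the top of `k` satisfies `p`. -/
inductive Cmd
  | skip
  | push (k : Reg) (x : Sym)
  | pop (k : Reg) (f : Option Sym → Cmd)
  | seq (d e : Cmd)
  | loop (k : Reg) (p : Option Sym → Bool) (d : Cmd)

/-- `Exec d s s' t`: the program `d`, started in the store `s`, ends in the store `s'` after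
exactly `t` steps of the machine into which it is compiled. -/
inductive Exec : Cmd → Store → Store → ℕ → Prop
  | skip (s) : Exec .skip s s 1
  | push (k x) (s : Store) : Exec (.push k x) s (s.set k (x :: s.get k)) 1
  | pop {k f} {s : Store} {s' t} (h : Exec (f (s.get k).head?) (s.set k (s.get k).tail) s' t) :
      Exec (.pop k f) s s' (1 + t)
  | seq {d e s₁ s₂ s₃ t u} (h : Exec d s₁ s₂ t) (h' : Exec e s₂ s₃ u) :
      Exec (.seq d e) s₁ s₃ (t + u)
  | done {k p d} {s : Store} (h : p (s.get k).head? = false) : Exec (.loop k p d) s s 1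
  | step {k p d} {s s₂ s₃ : Store} {t u} (hp : p (s.get k).head? = true) (h : Exec d s s₂ t)
      (h' : Exec (.loop k p d) s₂ s₃ u) : Exec (.loop k p d) s s₃ (1 + (t + u))

/-! ### Compilation into a stack machine -/

/-- The labels of the machine that runs a program. -/
def Cmd.Label : Cmd → Type
  | .skip => Unit
  | .push _ _ => Unit
  | .pop _ f => Unit ⊕ (o : Option Sym) × (f o).Label
  | .seq d e => d.Label ⊕ e.Label
  | .loop _ _ d => Unit ⊕ d.Label

/-- The label at which a program starts. -/
def Cmd.entry : (d : Cmd) → d.Label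
  | .skip => ()
  | .push _ _ => ()
  | .pop _ _ => .inl ()
  | .seq d _ => .inl d.entry
  | .loop _ _ _ => .inl ()

theorem Cmd.finite_label (d : Cmd) : Finite d.Label := by
  induction d with
  | skip => exact inferInstanceAs (Finite Unit)
  | push => exact inferInstanceAs (Finite Unit)
  | pop k f ih => exact inferInstanceAs (Finite (Unit ⊕ (o : Option Sym) × (f o).Label))
  | seq d e hd he => exact inferInstanceAs (Finite (d.Label ⊕ e.Label))
  | loop k p d hd => exact inferInstanceAs (Finite (Unit ⊕ d.Label))

open Turing in
/-- The statement at each label of a program that is part of a machine with labels `L`: the labels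
of the program are placed by `emb`, and the program goes on to `next` when it is finished. The
internal state of the machine holds the symbol that was read last. -/
def Cmd.code {L : Type} : (d : Cmd) → (emb : d.Label → L) → (next : L) → d.Label →
    TM2.Stmt (fun _ : Reg => Sym) L (Option Sym)
  | .skip, _, next, _ => .goto fun _ => next
  | .push k x, _, next, _ => .push k (fun _ => x) (.goto fun _ => next)
  | .pop k f, emb, _, .inl _ => .pop k (fun _ o => o) (.goto fun o => emb (.inr ⟨o, (f o).entry⟩))
  | .pop _ f, emb, next, .inr ⟨o, l⟩ => (f o).code (fun l => emb (.inr ⟨o, l⟩)) next l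
  | .seq d e, emb, _, .inl l => d.code (fun l => emb (.inl l)) (emb (.inr e.entry)) l
  | .seq _ e, emb, next, .inr l => e.code (fun l => emb (.inr l)) next l
  | .loop k p d, emb, next, .inl _ =>
      .peek k (fun _ o => o) (.branch p (.goto fun _ => emb (.inr d.entry)) (.goto fun _ => next))
  | .loop _ _ d, emb, _, .inr l => d.code (fun l => emb (.inr l)) (emb (.inl ())) l

theorem Store.update_get (s : Store) (k : Reg) (l : List Sym) :
    Function.update s.get k l = (s.set k l).get := by
  funext j
  cases k <;> cases j <;> rfl

/-- A machine that contains the code of a program simulates it step by step. -/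
theorem Exec.simulate {d : Cmd} {s s' : Store} {t : ℕ} (h : Exec d s s' t) {L : Type}
    (emb : d.Label → L) (next : L) (M : L → Turing.TM2.Stmt (fun _ : Reg => Sym) L (Option Sym))
    (hM : ∀ l, M (emb l) = d.code emb next l) (v : Option Sym) :
    ∃ v', (flip bind (Turing.TM2.step M))^[t] (some ⟨some (emb d.entry), v, s.get⟩) =
      some ⟨some next, v', s'.get⟩ := by
  induction h generalizing next v with
  | skip s =>
    refine ⟨v, ?_⟩
    change some (Turing.TM2.stepAux (M _) _ _) = _
    rw [hM]; rfl
  | push k x s =>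
    refine ⟨v, ?_⟩
    change some (Turing.TM2.stepAux (M _) _ _) = _
    rw [hM, ← Store.update_get]; rfl
  | @pop k f s s' t h ih =>
    obtain ⟨v', h'⟩ := ih (fun l => emb (.inr ⟨_, l⟩)) next (fun l => hM (.inr ⟨_, l⟩))
      (s.get k).head?
    refine ⟨v', ?_⟩
    rw [Nat.add_comm, Function.iterate_add_apply, ← h']
    congr 1
    change some (Turing.TM2.stepAux (M _) _ _) = _
    rw [hM, ← Store.update_get]; rfl
  | @seq d e s₁ s₂ s₃ t u h h' ih ih' =>
    obtain ⟨v₁, h₁⟩ := ih (fun l => emb (.inl l)) _ (fun l => hM (.inl l)) v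
    obtain ⟨v₂, h₂⟩ := ih' (fun l => emb (.inr l)) _ (fun l => hM (.inr l)) v₁
    refine ⟨v₂, ?_⟩
    rw [Nat.add_comm, Function.iterate_add_apply, ← h₂, ← h₁]; rfl
  | @done k p d s h =>
    refine ⟨(s.get k).head?, ?_⟩
    change some (Turing.TM2.stepAux (M _) _ _) = _
    rw [hM]
    simp [Cmd.code, Cmd.entry, h]
  | @step k p d s s₂ s₃ t u hp h h' ih ih' =>
    obtain ⟨v₁, h₁⟩ := ih (fun l => emb (.inr l)) (emb (.inl ())) (fun l => hM (.inr l))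
      (s.get k).head?
    obtain ⟨v₂, h₂⟩ := ih' emb next hM v₁
    refine ⟨v₂, ?_⟩
    rw [Nat.add_comm, Function.iterate_add_apply, Nat.add_comm t, Function.iterate_add_apply,
      ← h₂]
    congr 1
    refine Eq.trans ?_ h₁
    congr 1
    change some (Turing.TM2.stepAux (M _) _ _) = _
    rw [hM]
    simp [Cmd.code, Cmd.entry, hp]

/-- The machine that runs the program `d`; after the last command of `d` it resets its internal
state and halts. -/
noncomputable def Cmd.machine (d : Cmd) : Turing.FinTM2 :=
  haveI := d.finite_label
  letI := Fintype.ofFinite (Option d.Label)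
  { K := Reg
    k₀ := .a
    k₁ := .a
    Γ := fun _ => Sym
    Λ := Option d.Label
    main := some d.entry
    σ := Option Sym
    initialState := none
    m := fun l => match l with
      | none => .load (fun _ => none) .halt
      | some l => d.code some none l }

/-- A program that works in polynomial time on the codes of the instances yields a machine. -/
noncomputable def Cmd.computable {α β : Type} {ea : α → List Sym} {eb : β → List Sym} {f : α → β}
    (d : Cmd) (p : Polynomial ℕ)
    (h : ∀ x, ∃ t ≤ p.eval (ea x).length, Exec d (ea x, [], []) (eb (f x), [], []) t) :
    Turing.TM2ComputableInPolyTime ea eb f where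
  tm := d.machine
  inputAlphabet := Equiv.refl Sym
  outputAlphabet := Equiv.refl Sym
  time := p + 1
  outputsFun x :=
    { steps := (h x).choose + 1
      evals_in_steps := by
        have hx := (h x).choose_spec.2
        generalize (h x).choose = t at hx
        obtain ⟨v, hv⟩ := hx.simulate some none d.machine.m (fun l => rfl) none
        have h₁ : Turing.initList d.machine ((ea x).map (Equiv.refl Sym).invFun) =
            ⟨some (some d.entry), none, Store.get (ea x, [], [])⟩ := by
          change Turing.TM2.Cfg.mk _ _ _ = Turing.TM2.Cfg.mk _ _ _
          congr 1
          funext k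
          cases k
          · change List.map id (ea x) = ea x
            simp
          · rfl
          · rfl
        have h₂ : Turing.haltList d.machine ((eb (f x)).map (Equiv.refl Sym).invFun) =
            ⟨none, none, Store.get (eb (f x), [], [])⟩ := by
          change Turing.TM2.Cfg.mk _ _ _ = Turing.TM2.Cfg.mk _ _ _
          congr 1
          funext k
          cases k
          · change List.map id (eb (f x)) = eb (f x)
            simp
          · rfl
          · rfl
        rw [Option.map_some, h₁, h₂, Function.iterate_succ_apply']
        refine Eq.trans (congrArg _ hv) ?_
        rfl
      steps_le_m := by
        simpa using (h x).choose_spec.1 }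

/-- The total length of the stacks grows by at most one in each step. -/
theorem Exec.length_le {d : Cmd} {s s' : Store} {t : ℕ} (h : Exec d s s' t) :
    s'.1.length + s'.2.1.length + s'.2.2.length ≤ s.1.length + s.2.1.length + s.2.2.length + t := by
  induction h with
  | skip => omega
  | push k => cases k <;> simp [Store.get, Store.set] <;> omega
  | @pop k f s _ _ h ih => cases k <;> simp [Store.get, Store.set] at ih <;> omega
  | seq _ _ ih ih' => omega
  | done => omega
  | step _ _ _ ih ih' => omega

/-! ### Types with a code that a machine can read -/

/-- Execution within a bounded number of steps. -/
def Runs (d : Cmd) (s s' : Store) (n : ℕ) : Prop := ∃ t ≤ n, Exec d s s' t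

theorem Exec.runs {d : Cmd} {s s' : Store} {t n : ℕ} (h : Exec d s s' t) (hn : t ≤ n) :
    Runs d s s' n := ⟨t, hn, h⟩

theorem Runs.mono {d : Cmd} {s s' : Store} {m n : ℕ} (h : Runs d s s' m) (hn : m ≤ n) :
    Runs d s s' n := h.imp fun _ ht => ⟨ht.1.trans hn, ht.2⟩

theorem Runs.seq {d e : Cmd} {s₁ s₂ s₃ : Store} {m n : ℕ} (h : Runs d s₁ s₂ m)
    (h' : Runs e s₂ s₃ n) : Runs (.seq d e) s₁ s₃ (m + n) := by
  obtain ⟨t, ht, h⟩ := h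
  obtain ⟨u, hu, h'⟩ := h'
  exact ⟨t + u, by omega, h.seq h'⟩

theorem Runs.skip (s : Store) : Runs .skip s s 1 := (Exec.skip s).runs le_rfl

theorem Runs.push (k : Reg) (x : Sym) (s : Store) :
    Runs (.push k x) s (s.set k (x :: s.get k)) 1 := (Exec.push k x s).runs le_rfl

theorem Runs.pop {k : Reg} {f : Option Sym → Cmd} {s s' : Store} {n : ℕ}
    (h : Runs (f (s.get k).head?) (s.set k (s.get k).tail) s' n) :
    Runs (.pop k f) s s' (1 + n) := by
  obtain ⟨t, ht, h⟩ := h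
  exact ⟨1 + t, by omega, h.pop⟩

theorem Runs.done {k : Reg} {p : Option Sym → Bool} {d : Cmd} {s : Store}
    (h : p (s.get k).head? = false) : Runs (.loop k p d) s s 1 := (Exec.done h).runs le_rfl

theorem Runs.step {k : Reg} {p : Option Sym → Bool} {d : Cmd} {s s₂ s₃ : Store} {m n : ℕ}
    (hp : p (s.get k).head? = true) (h : Runs d s s₂ m) (h' : Runs (.loop k p d) s₂ s₃ n) :
    Runs (.loop k p d) s s₃ (1 + (m + n)) := by
  obtain ⟨t, ht, h⟩ := h
  obtain ⟨u, hu, h'⟩ := h'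
  exact ⟨1 + (t + u), by omega, h.step hp h'⟩

/-- Pop a symbol and continue with a program that depends on it. -/
def Cmd.popSym (k : Reg) (f : Sym → Cmd) : Cmd :=
  .pop k fun o => match o with
    | none => .skip
    | some x => f x

/-- The program `act` applied to a symbol leaves the stack `a` alone and changes the other two
stacks as told by `u`, in at most `k` steps. -/
def IsAction (act : Sym → Cmd) (u : List Sym × List Sym → Sym → List Sym × List Sym) (k : ℕ) :
    Prop :=
  ∀ x r w, Runs (act x) (r, w) (r, u w x) k

/-- `Scannable e`: a program can find the end of a code on the stack `a`, performing a given action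
on each of its symbols, in linear time. -/
def Scannable {α : Type} (e : α → List Sym) : Prop :=
  ∀ act u k, IsAction act u k → ∃ d K, ∀ x r w,
    Runs d (e x ++ r, w) (r, (e x).foldl u w) (K * ((e x).length + 1))

/-- Types whose elements are encoded by words over the alphabet, such that the end of a code can be
recognized by a machine. -/
class Code (α : Type) where
  enc : α → List Sym
  readable : Readable enc
  scannable : Scannable enc

open Code

/-- The length of the code. -/
def size {α : Type} [Code α] (x : α) : ℕ := (enc x).length

theorem IsAction.popSym {act : Sym → Cmd} {u : List Sym × List Sym → Sym → List Sym × List Sym}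
    {k : ℕ} (h : IsAction act u k) (x : Sym) (r : List Sym) (w : List Sym × List Sym) :
    Runs (.popSym .a act) (x :: r, w) (r, u w x) (1 + k) := (h x r w).pop

theorem scannable_single {α : Type} {e : α → List Sym} (g : α → Sym) (h : ∀ x, e x = [g x]) :
    Scannable e := by
  intro act u k ha
  refine ⟨.popSym .a act, 1 + k, fun x r w => ?_⟩
  rw [h]
  exact (ha.popSym _ _ _).mono (by simp)

theorem Scannable.pair {α β : Type} {ea : α → List Sym} {eb : β → List Sym}
    (ha : Scannable ea) (hb : Scannable eb) : Scannable (encPair ea eb) := by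
  intro act u k h
  obtain ⟨d, K, hd⟩ := ha act u k h
  obtain ⟨e, L, he⟩ := hb act u k h
  refine ⟨.seq d e, K + L, fun x r w => ?_⟩
  rw [encPair, List.append_assoc, List.foldl_append]
  refine ((hd _ _ _).seq (he _ _ _)).mono ?_
  rw [List.length_append]
  nlinarith [Nat.zero_le (K * (eb x.2).length), Nat.zero_le (L * (ea x.1).length)]

theorem encList_cons {α : Type} (ea : α → List Sym) (x : α) (l : List α) :
    encList ea (x :: l) = Sym.item :: (ea x ++ encList ea l) := by simp [encList]

theorem Scannable.list {α : Type} {ea : α → List Sym} (ha : Scannable ea) :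
    Scannable (encList ea) := by
  intro act u k h
  obtain ⟨d, K, hd⟩ := ha act u k h
  refine ⟨.seq (.loop .a (· == some .item) (.seq (.popSym .a act) d)) (.popSym .a act),
    3 + 2 * k + K, fun x r w => ?_⟩
  have key : ∀ (l : List α) (w : List Sym × List Sym), Runs
      (.loop .a (· == some .item) (.seq (.popSym .a act) d)) (encList ea l ++ r, w)
      (.close :: r, (l.flatMap fun a => .item :: ea a).foldl u w)
      (1 + (2 + k + K) * (l.flatMap fun a => .item :: ea a).length) := by
    intro l
    induction l with
    | nil => intro w; exact Runs.done rfl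
    | cons a l ih =>
      intro w
      rw [encList_cons, List.cons_append, List.append_assoc, List.flatMap_cons, List.foldl_append,
        List.foldl_cons]
      refine (Runs.step rfl ((h.popSym _ _ _).seq (hd _ _ _)) (ih _)).mono ?_
      rw [List.length_append, List.length_cons]
      nlinarith [Nat.zero_le (k * (ea a).length)]
  have := (key x w).seq (h.popSym _ _ _)
  rw [show (encList ea x).foldl u w = u ((x.flatMap fun a => .item :: ea a).foldl u w) .close by
    rw [encList, List.foldl_append]; rfl]
  refine this.mono ?_
  rw [encList, List.length_append, List.length_singleton]
  nlinarith [Nat.zero_le ((k + 1) * (x.flatMap fun a => .item :: ea a).length)]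

theorem scannable_encNat : Scannable encNat := by
  intro act u k h
  refine ⟨.seq (.loop .a (fun o => o != some .endNum) (.popSym .a act)) (.popSym .a act),
    2 + k, fun x r w => ?_⟩
  have key : ∀ (l : List Bool) (w : List Sym × List Sym), Runs
      (.loop .a (fun o => o != some .endNum) (.popSym .a act)) (l.map Sym.bit ++ .endNum :: r, w)
      (.endNum :: r, (l.map Sym.bit).foldl u w) (1 + (2 + k) * l.length) := by
    intro l
    induction l with
    | nil => intro w; exact Runs.done rfl
    | cons a l ih =>
      intro w
      refine (Runs.step rfl (h.popSym _ _ _) (ih _)).mono ?_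
      rw [List.length_cons]
      nlinarith
  rw [encNat, List.append_assoc, List.foldl_append, List.length_append, List.length_map]
  refine ((key x.bits w).seq (h.popSym _ _ _)).mono ?_
  simp
  nlinarith

theorem encRat_eq (q : ℚ) : encRat q =
    (if q < 0 then [Sym.minus] else []) ++ encPair encNat encNat (q.num.natAbs, q.den) := by
  simp [encRat, encPair]

theorem scannable_encRat : Scannable encRat := by
  intro act u k h
  obtain ⟨d, K, hd⟩ := scannable_encNat.pair scannable_encNat act u k h
  refine ⟨.seq (.loop .a (· == some .minus) (.popSym .a act)) d, 3 + k + K, fun q r w => ?_⟩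
  rw [encRat_eq]
  have h₀ : ∀ w : List Sym × List Sym, Runs (.loop .a (· == some .minus) (.popSym .a act))
      (encPair encNat encNat (q.num.natAbs, q.den) ++ r, w)
      (encPair encNat encNat (q.num.natAbs, q.den) ++ r, w) 1 := by
    intro w
    refine Runs.done ?_
    change ((encPair encNat encNat (q.num.natAbs, q.den) ++ r).head? == _) = _
    rw [encPair, List.append_assoc]
    cases hb : q.num.natAbs.bits <;> simp [encNat, hb]
  split_ifs with hq
  · refine ((Runs.step rfl (h.popSym _ _ _) (h₀ _)).seq (hd _ _ _)).mono ?_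
    rw [List.length_append, List.length_singleton]
    nlinarith [Nat.zero_le ((k + 1) * (encPair encNat encNat (q.num.natAbs, q.den)).length)]
  · refine ((h₀ _).seq (hd _ _ _)).mono ?_
    rw [List.length_append, List.length_nil]
    nlinarith [Nat.zero_le ((k + 1) * (encPair encNat encNat (q.num.natAbs, q.den)).length)]

instance : Code Bool where
  enc b := [Sym.bit b]
  readable a b u v h := by simpa using h
  scannable := scannable_single Sym.bit fun _ => rfl

instance : Code Unit where
  enc _ := []
  readable a b u v h := by simpa using h
  scannable act u k h := ⟨.skip, 1, fun _ _ _ => Runs.skip _⟩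

instance : Code ℕ := ⟨encNat, readable_encNat, scannable_encNat⟩

instance : Code ℚ := ⟨encRat, readable_encRat, scannable_encRat⟩

instance : Code Rel :=
  ⟨encRel, readable_encRel,
    scannable_single (fun r => match r with | .le => Sym.le | .eq => Sym.eq | .ge => Sym.ge)
      fun r => by cases r <;> rfl⟩

instance {α β : Type} [Code α] [Code β] : Code (α × β) :=
  ⟨encPair enc enc, readable.pair readable, scannable.pair scannable⟩

instance {α : Type} [Code α] : Code (List α) :=
  ⟨encList enc, readable.list, scannable.list⟩

/-- A code that is taken over from another type is scannable if the given one is. -/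
theorem Scannable.comp {α β : Type} {e : β → List Sym} (h : Scannable e) {e' : α → List Sym}
    (g : α → β) (hg : ∀ x, e' x = e (g x)) : Scannable e' := by
  intro act u k ha
  obtain ⟨d, K, hd⟩ := h act u k ha
  exact ⟨d, K, fun x r w => by rw [hg]; exact hd _ _ _⟩

instance : Code Window :=
  ⟨encWindow, readable_encWindow, (Code.scannable (α := List (ℚ × ℚ) × Rel × ℕ)).comp
    (fun w => (w.points, w.rel, w.bound)) fun w => by simp [encWindow, enc, encPair]⟩

instance : Code Slice :=
  ⟨encSlice, readable_encSlice,
    (Code.scannable (α := List (ℚ × ℕ) × List (ℚ × ℕ) × List Window)).comp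
    (fun S => (S.rows, S.cols, S.windows)) fun S => by simp [encSlice, enc, encPair]⟩

instance {α : Type} [Code α] : Code (Option α) where
  enc := encAnswer enc
  readable a b u v h := by
    cases a <;> cases b <;> simp [encAnswer] at h ⊢
    · exact h
    · exact readable _ _ _ _ h
  scannable act u k h := by
    obtain ⟨d, K, hd⟩ := scannable (α := α) act u k h
    refine ⟨.pop .a fun o => match o with
      | none => .skip
      | some x => .seq (act x) (if x = .item then d else .skip), 2 + k + K, fun x r w => ?_⟩
    cases x with
    | none =>
      refine (Runs.pop ((h _ _ _).seq (Runs.skip _))).mono ?_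
      simp [encAnswer]; nlinarith
    | some x =>
      refine (Runs.pop ((h _ _ _).seq (hd _ _ _))).mono ?_
      simp [encAnswer]; nlinarith

/-! ### Functions computable in polynomial time -/

/-- The function `f` is computed in polynomial time by a program that replaces the code of `x` on
top of the stack `a` by the code of `f x`, and leaves everything below and the other two stacks as
they were. -/
@[fun_prop]
def PolyTime {α β : Type} [Code α] [Code β] (f : α → β) : Prop :=
  ∃ (d : Cmd) (p : Polynomial ℕ), ∀ x r w,
    Runs d (enc x ++ r, w) (enc (f x) ++ r, w) (p.eval (size x))

theorem eval_le_eval (p : Polynomial ℕ) {m n : ℕ} (h : m ≤ n) : p.eval m ≤ p.eval n := by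
  rw [Polynomial.eval_eq_sum_range, Polynomial.eval_eq_sum_range]
  gcongr

theorem enc_pair {α β : Type} [Code α] [Code β] (x : α × β) : enc x = enc x.1 ++ enc x.2 := rfl

theorem enc_cons {α : Type} [Code α] (a : α) (l : List α) :
    enc (a :: l) = Sym.item :: (enc a ++ enc l) := encList_cons _ _ _

theorem size_pair {α β : Type} [Code α] [Code β] (x : α × β) : size x = size x.1 + size x.2 := by
  simp [size, enc_pair]

theorem size_nil {α : Type} [Code α] : size ([] : List α) = 1 := rfl

theorem size_cons {α : Type} [Code α] (a : α) (l : List α) :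
    size (a :: l) = size a + size l + 1 := by
  simp [size, enc_cons]

section polyTime

variable {α β γ δ σ : Type} [Code α] [Code β] [Code γ] [Code δ] [Code σ]

theorem PolyTime.size_le {f : α → β} (hf : PolyTime f) :
    ∃ p : Polynomial ℕ, ∀ x, size (f x) ≤ p.eval (size x) := by
  obtain ⟨d, p, h⟩ := hf
  refine ⟨Polynomial.X + p, fun x => ?_⟩
  obtain ⟨t, ht, he⟩ := h x [] ([], [])
  have := he.length_le
  simp [size] at this ht ⊢
  omega

/-- A word as it is kept on an auxiliary stack: each symbol lies under an `item`, so that the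
bottom of the word can be marked by `close`. -/
def cells (u l : List Sym) : List Sym := u.foldl (fun l x => .item :: x :: l) l

/-- Move a word from an auxiliary stack back to the stack `a`. -/
def Cmd.restore (k : Reg) : Cmd :=
  .seq (.loop k (· == some .item) (.pop k fun _ => .popSym k (.push .a))) (.pop k fun _ => .skip)

theorem runs_restore_b (u r v w : List Sym) :
    Runs (.restore .b) (r, cells u (.close :: v), w) (u ++ r, v, w) (4 * u.length + 3) := by
  have key : ∀ (u r : List Sym), Runs
      (.loop .b (· == some .item) (.pop .b fun _ => .popSym .b (.push .a)))
      (r, cells u (.close :: v), w) (u ++ r, .close :: v, w) (4 * u.length + 1) := by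
    intro u
    induction u using List.reverseRecOn with
    | nil => intro r; exact Runs.done rfl
    | append_singleton u x ih =>
      intro r
      rw [cells, List.foldl_append, List.append_assoc]
      refine (Runs.step rfl (Runs.pop (Runs.pop (Runs.push _ _ _))) (ih (x :: r))).mono ?_
      simp; omega
  exact (key u r).seq (Runs.pop (k := .b) (f := fun _ => .skip) (Runs.skip _))

theorem runs_restore_c (u r v w : List Sym) :
    Runs (.restore .c) (r, w, cells u (.close :: v)) (u ++ r, w, v) (4 * u.length + 3) := by
  have key : ∀ (u r : List Sym), Runs
      (.loop .c (· == some .item) (.pop .c fun _ => .popSym .c (.push .a)))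
      (r, w, cells u (.close :: v)) (u ++ r, w, .close :: v) (4 * u.length + 1) := by
    intro u
    induction u using List.reverseRecOn with
    | nil => intro r; exact Runs.done rfl
    | append_singleton u x ih =>
      intro r
      rw [cells, List.foldl_append, List.append_assoc]
      refine (Runs.step rfl (Runs.pop (Runs.pop (Runs.push _ _ _))) (ih (x :: r))).mono ?_
      simp; omega
  exact (key u r).seq (Runs.pop (k := .c) (f := fun _ => .skip) (Runs.skip _))

variable (α) in
theorem exists_move_b : ∃ d K, ∀ (x : α) r v w,
    Runs d (enc x ++ r, v, w) (r, cells (enc x) v, w) (K * (size x + 1)) := by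
  obtain ⟨d, K, h⟩ := scannable (α := α) (fun x => .seq (.push .b x) (.push .b .item))
    (fun w x => (.item :: x :: w.1, w.2)) 2 fun x r w => (Runs.push _ _ _).seq (Runs.push _ _ _)
  refine ⟨d, K, fun x r v w => ?_⟩
  have : ∀ u v, List.foldl (fun (w : List Sym × List Sym) x => (Sym.item :: x :: w.1, w.2))
      (v, w) u = (cells u v, w) := by
    intro u
    induction u with
    | nil => intro v; rfl
    | cons x u ih => intro v; exact ih _
  simpa only [this, size] using h x r (v, w)

variable (α) in
theorem exists_move_c : ∃ d K, ∀ (x : α) r v w,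
    Runs d (enc x ++ r, v, w) (r, v, cells (enc x) w) (K * (size x + 1)) := by
  obtain ⟨d, K, h⟩ := scannable (α := α) (fun x => .seq (.push .c x) (.push .c .item))
    (fun w x => (w.1, .item :: x :: w.2)) 2 fun x r w => (Runs.push _ _ _).seq (Runs.push _ _ _)
  refine ⟨d, K, fun x r v w => ?_⟩
  have : ∀ u w, List.foldl (fun (w : List Sym × List Sym) x => (w.1, Sym.item :: x :: w.2))
      (v, w) u = (v, cells u w) := by
    intro u
    induction u with
    | nil => intro v; rfl
    | cons x u ih => intro v; exact ih _
  simpa only [this, size] using h x r (v, w)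

variable (α) in
theorem exists_move_bc : ∃ d K, ∀ (x : α) r v w,
    Runs d (enc x ++ r, v, w) (r, cells (enc x) v, cells (enc x) w) (K * (size x + 1)) := by
  obtain ⟨d, K, h⟩ := scannable (α := α)
    (fun x => .seq (.push .b x) (.seq (.push .b .item) (.seq (.push .c x) (.push .c .item))))
    (fun w x => (.item :: x :: w.1, .item :: x :: w.2)) 4 fun x r w =>
      (Runs.push _ _ _).seq ((Runs.push _ _ _).seq ((Runs.push _ _ _).seq (Runs.push _ _ _)))
  refine ⟨d, K, fun x r v w => ?_⟩
  have : ∀ u v w, List.foldl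
      (fun (w : List Sym × List Sym) x => (Sym.item :: x :: w.1, Sym.item :: x :: w.2))
      (v, w) u = (cells u v, cells u w) := by
    intro u
    induction u with
    | nil => intro v w; rfl
    | cons x u ih => intro v w; exact ih _ _
  simpa only [this, size] using h x r (v, w)

variable (α) in
theorem exists_drop : ∃ d K, ∀ (x : α) r w, Runs d (enc x ++ r, w) (r, w) (K * (size x + 1)) := by
  obtain ⟨d, K, h⟩ := scannable (α := α) (fun _ => .skip) (fun w _ => w) 1 fun x r w => Runs.skip _
  refine ⟨d, K, fun x r w => ?_⟩
  have : ∀ u, List.foldl (fun (w : List Sym × List Sym) (_ : Sym) => w) w u = w := by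
    intro u
    induction u with
    | nil => rfl
    | cons x u ih => exact ih
  simpa only [this, size] using h x r w

@[fun_prop]
theorem PolyTime.id : PolyTime fun x : α => x :=
  ⟨.skip, 1, fun _ _ _ => (Runs.skip _).mono (by simp)⟩

/-- If a function does not change the code, nothing has to be done. -/
theorem PolyTime.of_enc_eq {f : α → β} (h : ∀ x, enc (f x) = enc x) : PolyTime f :=
  ⟨.skip, 1, fun x _ _ => by rw [h]; exact (Runs.skip _).mono (by simp)⟩

@[fun_prop]
theorem PolyTime.comp {g : β → γ} {f : α → β} (hg : PolyTime g) (hf : PolyTime f) :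
    PolyTime fun x => g (f x) := by
  obtain ⟨q, hq⟩ := hf.size_le
  obtain ⟨d, p, hd⟩ := hf
  obtain ⟨e, s, he⟩ := hg
  refine ⟨.seq d e, p + s.comp q, fun x r w => ((hd x r w).seq (he _ r w)).mono ?_⟩
  simpa using eval_le_eval s (hq x)

@[fun_prop]
theorem PolyTime.const (x : β) : PolyTime fun _ : α => x := by
  obtain ⟨d, K, hd⟩ := exists_drop α
  have key : ∀ u : List Sym, ∃ d, ∀ r w, Runs d (r, w) (u ++ r, w) (u.length + 1) := by
    intro u
    induction u with
    | nil => exact ⟨.skip, fun r w => Runs.skip _⟩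
    | cons y u ih =>
      obtain ⟨e, he⟩ := ih
      exact ⟨.seq e (.push .a y), fun r w => (he r w).seq (Runs.push _ _ _)⟩
  obtain ⟨e, he⟩ := key (enc x)
  refine ⟨.seq d e, Polynomial.C K * (.X + 1) + Polynomial.C (size x + 1), fun y r w => ?_⟩
  refine ((hd y r w).seq (he r w)).mono ?_
  simp [size]

@[fun_prop]
theorem PolyTime.pair {f : α → β} {g : α → γ} (hf : PolyTime f) (hg : PolyTime g) :
    PolyTime fun x => (f x, g x) := by
  obtain ⟨q, hq⟩ := hf.size_le
  obtain ⟨d, p, hd⟩ := hf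
  obtain ⟨e, s, he⟩ := hg
  obtain ⟨d₁, K, h₁⟩ := exists_move_bc α
  obtain ⟨d₂, L, h₂⟩ := exists_move_b β
  refine ⟨.seq (.push .b .close) (.seq (.push .c .close) (.seq d₁ (.seq (.restore .b)
    (.seq (.restore .c) (.seq d (.seq (.push .b .close) (.seq d₂ (.seq e (.restore .b))))))))),
    12 + Polynomial.C (K + 8) * (.X + 1) + p + Polynomial.C (L + 4) * (q + 1) + s,
    fun x r w => ?_⟩
  have h₃ := runs_restore_b (enc (f x)) (enc (g x) ++ r) w.1 w.2
  rw [← List.append_assoc] at h₃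
  refine Runs.mono ((Runs.push _ _ _).seq ((Runs.push _ _ _).seq ((h₁ x r _ _).seq
    ((runs_restore_b _ _ _ _).seq ((runs_restore_c _ _ _ _).seq ((hd _ _ _).seq
      ((Runs.push _ _ _).seq ((h₂ _ _ _ _).seq ((he _ _ _).seq h₃))))))))) ?_
  simp only [Polynomial.eval_add, Polynomial.eval_mul, Polynomial.eval_C, Polynomial.eval_X,
      Polynomial.eval_ofNat, Polynomial.eval_one]
  have := hq x
  change _ + (_ + (_ + (4 * size x + 3 + (4 * size x + 3 + (_ + (_ + (_ + (_ +
    (4 * size (f x) + 3)))))))))  ≤ _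
  nlinarith

@[fun_prop]
theorem PolyTime.snd {f : α → β × γ} (hf : PolyTime f) : PolyTime fun x => (f x).2 := by
  suffices h : PolyTime fun x : β × γ => x.2 from h.comp hf
  obtain ⟨d, K, h⟩ := exists_drop β
  refine ⟨d, Polynomial.C K * (.X + 1), fun x r w => ?_⟩
  rw [enc_pair, List.append_assoc]
  refine (h x.1 _ w).mono ?_
  simp [size_pair]
  nlinarith

@[fun_prop]
theorem PolyTime.fst {f : α → β × γ} (hf : PolyTime f) : PolyTime fun x => (f x).1 := by
  suffices h : PolyTime fun x : β × γ => x.1 from h.comp hf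
  obtain ⟨d, K, h⟩ := exists_move_b β
  obtain ⟨e, L, h'⟩ := exists_drop γ
  refine ⟨.seq (.push .b .close) (.seq d (.seq e (.restore .b))),
    Polynomial.C (K + L + 8) * (.X + 1), fun x r w => ?_⟩
  rw [enc_pair, List.append_assoc]
  refine ((Runs.push _ _ _).seq ((h _ _ _ _).seq ((h' _ _ _).seq
    (runs_restore_b _ _ _ _)))).mono ?_
  simp only [Polynomial.eval_add, Polynomial.eval_mul, Polynomial.eval_C, Polynomial.eval_X,
      Polynomial.eval_one, size_pair]
  change _ + (_ + (_ + (4 * size x.1 + 3))) ≤ _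
  nlinarith [Nat.zero_le (K * size x.2), Nat.zero_le (L * size x.1)]

@[fun_prop]
theorem PolyTime.ite {p : α → Bool} {f g : α → β} (hp : PolyTime p) (hf : PolyTime f)
    (hg : PolyTime g) : PolyTime fun x => if p x = true then f x else g x := by
  suffices h : PolyTime fun x : Bool × α => if x.1 = true then f x.2 else g x.2 from
    h.comp (hp.pair .id)
  obtain ⟨d, p, hd⟩ := hf
  obtain ⟨e, q, he⟩ := hg
  refine ⟨.pop .a fun o => if o = some (.bit true) then d else e, 1 + p + q, fun x r w => ?_⟩
  obtain ⟨b, x⟩ := x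
  have hs : size x ≤ size (b, x) := by simp [size_pair]
  cases b
  · refine (Runs.pop (he x r w)).mono ?_
    have := eval_le_eval q hs
    simp
    omega
  · refine (Runs.pop (hd x r w)).mono ?_
    have := eval_le_eval p hs
    simp
    omega

@[fun_prop]
theorem PolyTime.cons {f : α → β} {g : α → List β} (hf : PolyTime f) (hg : PolyTime g) :
    PolyTime fun x => f x :: g x := by
  suffices h : PolyTime fun x : β × List β => x.1 :: x.2 from h.comp (hf.pair hg)
  refine ⟨.push .a .item, 1, fun x r w => ?_⟩
  rw [enc_cons]
  exact (Runs.push _ _ _).mono (by simp)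

@[fun_prop]
theorem PolyTime.some {f : α → β} (hf : PolyTime f) : PolyTime fun x => some (f x) := by
  suffices h : PolyTime fun x : β => Option.some x from h.comp hf
  exact ⟨.push .a .item, 1, fun x r w => (Runs.push _ _ _).mono (by simp)⟩

/-- Case distinction on a list. -/
theorem PolyTime.list_cases {l : α → List β} {f : α → γ} {g : (β × List β) × α → γ}
    (hl : PolyTime l) (hf : PolyTime f) (hg : PolyTime g) :
    PolyTime fun x => match l x with
      | [] => f x
      | b :: t => g ((b, t), x) := by
  suffices h : PolyTime fun x : List β × α => match x.1 with
      | [] => f x.2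
      | b :: t => g ((b, t), x.2) from h.comp (hl.pair .id)
  obtain ⟨d, p, hd⟩ := hf
  obtain ⟨e, q, he⟩ := hg
  refine ⟨.pop .a fun o => if o = Option.some .item then e else d, 1 + p + q, fun x r w => ?_⟩
  obtain ⟨l, x⟩ := x
  cases l with
  | nil =>
    refine (Runs.pop (hd x r w)).mono ?_
    have := eval_le_eval p (show size x ≤ size (([] : List β), x) by simp [size_pair])
    simp
    omega
  | cons b t =>
    refine (Runs.pop (?_ : Runs _ _ _ (q.eval (size ((b, t), x))))).mono ?_
    · simpa [enc_pair, enc_cons] using! he ((b, t), x) r w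
    · have := eval_le_eval q (show size ((b, t), x) ≤ size (b :: t, x) by
        simp [size_pair, size_cons])
      simp
      omega

theorem length_le_size (l : List α) : l.length ≤ size l := by
  induction l with
  | nil => simp
  | cons a l ih => simp [size_cons]; omega

/-- Iteration along a list, provided that the intermediate results have polynomial size. -/
theorem PolyTime.foldl_of_size {f : σ × α → σ} (hf : PolyTime f) (q : Polynomial ℕ)
    (hq : ∀ (l l' : List α) (s : σ), l' <+: l →
      size (l'.foldl (fun s a => f (s, a)) s) ≤ q.eval (size l + size s)) :
    PolyTime fun x : List α × σ => x.1.foldl (fun s a => f (s, a)) x.2 := by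
  obtain ⟨d, p, hd⟩ : PolyTime fun x : (α × List α) × σ => (x.1.2, f (x.2, x.1.1)) := by fun_prop
  have key : ∀ (N B : ℕ) (l : List α) (s : σ), size l ≤ N →
      (∀ l', l' <+: l → size (l'.foldl (fun s a => f (s, a)) s) ≤ B) → ∀ r w,
      Runs (.loop .a (· == Option.some .item) (.pop .a fun _ => d)) (enc l ++ (enc s ++ r), w)
        (.close :: (enc (l.foldl (fun s a => f (s, a)) s) ++ r), w)
        (1 + l.length * (2 + p.eval (N + B))) := by
    intro N B l
    induction l with
    | nil =>
      intro s _ _ r w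
      refine Runs.mono (m := 1) (Runs.done (s := (.close :: (enc s ++ r), w)) rfl) (by simp)
    | cons a l ih =>
      intro s hN hB r w
      rw [size_cons] at hN
      have h₁ := ih (f (s, a)) (by omega) (fun l' hl' => hB (a :: l') (by simpa using hl')) r w
      have h₂ := hd ((a, l), s) (r) w
      have h₃ := eval_le_eval p (show size ((a, l), s) ≤ N + B by
        have := hB [] (by simp)
        simp only [size_pair, List.foldl_nil] at this ⊢
        omega)
      simp only [enc_pair, List.append_assoc] at h₂
      rw [enc_cons, List.cons_append, List.append_assoc]
      refine (Runs.step rfl (Runs.pop h₂) h₁).mono ?_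
      rw [List.length_cons, Nat.add_mul]
      omega
  refine ⟨.seq (.loop .a (· == Option.some .item) (.pop .a fun _ => d)) (.pop .a fun _ => .skip),
    3 + .X * (2 + p.comp (.X + q)), fun x r w => ?_⟩
  obtain ⟨l, s⟩ := x
  have h₁ := key (size l) (q.eval (size l + size s)) l s le_rfl (fun l' hl' => hq l l' s hl') r w
  simp only [enc_pair, List.append_assoc]
  refine (h₁.seq (Runs.pop (Runs.skip _))).mono ?_
  simp only [Polynomial.eval_add, Polynomial.eval_mul, Polynomial.eval_comp, Polynomial.eval_X,
    Polynomial.eval_ofNat, size_pair]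
  have h₂ : l.length ≤ size l + size s := (length_le_size l).trans (Nat.le_add_right _ _)
  have h₃ := eval_le_eval p (show size l + q.eval (size l + size s) ≤
    size l + size s + q.eval (size l + size s) by omega)
  have := Nat.mul_le_mul h₂ (Nat.add_le_add_left h₃ 2)
  omega

/-! ### Equality tests and binary digits -/

theorem enc_injective {α : Type} [Code α] : Function.Injective (enc : α → List Sym) :=
  fun a b h => (readable a b [] [] (by rw [h])).1

theorem cells_eq (u l : List Sym) : cells u l = u.reverse.flatMap (fun x => [.item, x]) ++ l := by
  induction u generalizing l with
  | nil => rfl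
  | cons x u ih => rw [cells, List.foldl_cons, ← cells, ih]; simp

/-- Replace the flag on top of the stack `a` by `false`. -/
def Cmd.clearFlag : Cmd := .pop .a fun _ => .push .a (.bit false)

/-- Take words off the stacks `b` and `c` symbol by symbol, and clear the flag when they differ,
until the word on `b` is used up. -/
def Cmd.compare : Cmd :=
  .loop .b (· == some .item) (.pop .b fun _ => .popSym .b fun x => .pop .c fun o =>
    if o = some .item then .popSym .c fun y => if x = y then .skip else .clearFlag
    else .seq (.push .c .close) .clearFlag)

theorem runs_compare (u u' : List Sym) (f : Bool) (r v w : List Sym) :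
    ∃ (u'' : List Sym) (f' : Bool), u''.length ≤ u'.length ∧
      ((f' = true ∧ u'' = []) ↔ (f = true ∧ u = u')) ∧
      Runs .compare
        (.bit f :: r, u.flatMap (fun x => [.item, x]) ++ .close :: v,
          u'.flatMap (fun x => [.item, x]) ++ .close :: w)
        (.bit f' :: r, .close :: v, u''.flatMap (fun x => [.item, x]) ++ .close :: w)
        (1 + 10 * u.length) := by
  induction u generalizing u' f with
  | nil => exact ⟨u', f, le_rfl, by simp [eq_comm], Runs.done rfl⟩
  | cons x u ih =>
    cases u' with
    | nil =>
      obtain ⟨u'', f', h₁, h₂, h₃⟩ := ih [] false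
      refine ⟨u'', f', h₁, by simpa using h₂, (Runs.step rfl (Runs.pop (Runs.pop (Runs.pop
        ((Runs.push _ _ _).seq (Runs.pop (Runs.push _ _ _)))))) h₃).mono ?_⟩
      simp; omega
    | cons y u' =>
      by_cases hxy : x = y
      · obtain ⟨u'', f', h₁, h₂, h₃⟩ := ih u' f
        have h₄ : ∀ s, Runs (if x = y then .skip else .clearFlag) s s 1 := fun s => by
          rw [if_pos hxy]
          exact Runs.skip s
        refine ⟨u'', f', by simp; omega, by simpa [hxy] using h₂, (Runs.step rfl (Runs.pop
          (Runs.pop (Runs.pop (Runs.pop (h₄ _))))) h₃).mono ?_⟩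
        simp; omega
      · obtain ⟨u'', f', h₁, h₂, h₃⟩ := ih u' false
        have h₄ : ∀ r w, Runs (if x = y then .skip else .clearFlag) (.bit f :: r, w)
            (.bit false :: r, w) 2 := fun r w => by
          rw [if_neg hxy]
          exact Runs.pop (k := .a) (f := fun _ => .push .a (.bit false)) (Runs.push _ _ _)
        refine ⟨u'', f', by simp; omega, by simpa [hxy] using h₂, (Runs.step rfl (Runs.pop
          (Runs.pop (Runs.pop (Runs.pop (h₄ _ _))))) h₃).mono ?_⟩
        simp; omega

/-- Discard a word on the stack `c`, and clear the flag if the word is not empty. -/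
def Cmd.checkEmpty : Cmd :=
  .loop .c (· == some .item) (.pop .c fun _ => .pop .c fun _ => .clearFlag)

theorem runs_checkEmpty (u : List Sym) (f : Bool) (r v w : List Sym) :
    Runs .checkEmpty (.bit f :: r, v, u.flatMap (fun x => [.item, x]) ++ .close :: w)
      (.bit (f && decide (u = [])) :: r, v, .close :: w) (1 + 5 * u.length) := by
  induction u generalizing f with
  | nil => simpa using! Runs.mono (m := 1) (Runs.done rfl) (by omega)
  | cons x u ih =>
    have h := ih false
    rw [Bool.false_and] at h
    rw [show (f && decide (x :: u = [])) = false by simp]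
    refine (Runs.step rfl (Runs.pop (Runs.pop (Runs.pop (Runs.push _ _ _)))) h).mono ?_
    simp; omega

@[fun_prop]
theorem PolyTime.eq [DecidableEq β] {f g : α → β} (hf : PolyTime f) (hg : PolyTime g) :
    PolyTime fun x => decide (f x = g x) := by
  suffices h : PolyTime fun x : β × β => decide (x.1 = x.2) from h.comp (hf.pair hg)
  obtain ⟨d, K, hd⟩ := exists_move_b β
  obtain ⟨e, L, he⟩ := exists_move_c β
  refine ⟨.seq (.push .b .close) (.seq d (.seq (.push .c .close) (.seq e
    (.seq (.push .a (.bit true)) (.seq .compare (.seq (.pop .b fun _ => .skip)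
      (.seq .checkEmpty (.pop .c fun _ => .skip)))))))),
    9 + Polynomial.C (K + L + 15) * (.X + 1), fun x r w => ?_⟩
  obtain ⟨x, y⟩ := x
  obtain ⟨u, f, h₁, h₂, h₃⟩ := runs_compare (enc x).reverse (enc y).reverse true r w.1 w.2
  have h₄ := runs_checkEmpty u f r w.1 w.2
  have h₅ := (hd x (enc y ++ r) (.close :: w.1) w.2)
  have h₆ := (he y r (cells (enc x) (.close :: w.1)) (.close :: w.2))
  rw [cells_eq, cells_eq] at h₆
  rw [cells_eq] at h₅
  rw [← List.append_assoc] at h₅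
  have hfu : enc (decide (x = y)) = [Sym.bit (f && decide (u = []))] := by
    change [Sym.bit _] = _
    congr 2
    rw [Bool.eq_iff_iff]
    simp [h₂, enc_injective.eq_iff]
  simp only [hfu]
  refine ((Runs.push _ _ _).seq (h₅.seq ((Runs.push _ _ _).seq (h₆.seq ((Runs.push _ _ _).seq
    (h₃.seq (Runs.seq (Runs.pop (k := .b) (f := fun _ => .skip) (Runs.skip _)) (h₄.seq
      (Runs.pop (k := .c) (f := fun _ => .skip) (Runs.skip _)))))))))).mono ?_
  simp only [Polynomial.eval_add, Polynomial.eval_mul, Polynomial.eval_C, Polynomial.eval_X,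
    Polynomial.eval_ofNat, Polynomial.eval_one, size_pair, List.length_reverse] at h₁ ⊢
  change _ ≤ size y at h₁
  change _ + (_ + (_ + (_ + (_ + (1 + 10 * size x + _))))) ≤ _
  nlinarith [Nat.zero_le (K * size y), Nat.zero_le (L * size x)]

theorem PolyTime.bits : PolyTime Nat.bits := by
  obtain ⟨d, K, hd⟩ := exists_move_b ℕ
  refine ⟨.seq (.push .b .close) (.seq d (.seq (.pop .b fun _ => .pop .b fun _ => .skip)
    (.seq (.push .a .close) (.seq (.loop .b (· == Option.some .item)
      (.pop .b fun _ => .popSym .b fun x => .seq (.push .a x) (.push .a .item)))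
      (.pop .b fun _ => .skip))))), 8 + Polynomial.C (K + 5) * (.X + 1), fun n r w => ?_⟩
  have key : ∀ (l m : List Bool), Runs (.loop .b (· == Option.some .item)
      (.pop .b fun _ => .popSym .b fun x => .seq (.push .a x) (.push .a .item)))
      (enc m ++ r, cells (l.map Sym.bit) (.close :: w.1), w.2)
      (enc (l ++ m) ++ r, .close :: w.1, w.2) (1 + 5 * l.length) := by
    intro l
    induction l using List.reverseRecOn with
    | nil => intro m; exact Runs.done rfl
    | append_singleton l x ih =>
      intro m
      rw [List.append_assoc, List.map_append, cells, List.foldl_append, ← cells]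
      refine (Runs.step rfl (Runs.pop (Runs.pop ((Runs.push _ _ _).seq (Runs.push _ _ _))))
        (ih (x :: m))).mono ?_
      simp; omega
  have h₁ := hd n r (.close :: w.1) w.2
  have h₂ := key n.bits []
  rw [List.append_nil] at h₂
  rw [show cells (enc n) (.close :: w.1) = .item :: .endNum ::
    cells (n.bits.map Sym.bit) (.close :: w.1) by
      change cells (n.bits.map Sym.bit ++ [Sym.endNum]) _ = _
      rw [cells, List.foldl_append]; rfl] at h₁
  refine ((Runs.push _ _ _).seq (h₁.seq (Runs.seq (Runs.pop (k := .b)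
    (f := fun _ => .pop .b fun _ => .skip) (Runs.pop (Runs.skip _))) ((Runs.push _ _ _).seq
      (h₂.seq (Runs.pop (k := .b) (f := fun _ => .skip) (Runs.skip _))))))).mono ?_
  have : n.bits.length ≤ size n := by
    change _ ≤ (n.bits.map Sym.bit ++ [Sym.endNum]).length
    simp
  simp only [Polynomial.eval_add, Polynomial.eval_mul, Polynomial.eval_C, Polynomial.eval_X,
    Polynomial.eval_ofNat, Polynomial.eval_one]
  nlinarith

/-! ### Functions on lists -/

theorem size_le_of_prefix {l' l : List α} (h : l' <+: l) : size l' ≤ size l := by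
  obtain ⟨l, rfl⟩ := h
  induction l' with
  | nil => cases l <;> simp [size_nil, size_cons]
  | cons a l' ih => rw [List.cons_append, size_cons, size_cons]; omega

/-- Iteration along a list with a parameter, when each step increases the size by an amount that is
bounded in terms of the parameter and the entry of the list. -/
theorem PolyTime.foldl {l : α → List β} {s : α → σ} {f : α → σ → β → σ} (hl : PolyTime l)
    (hs : PolyTime s) (hf : PolyTime fun x : (α × σ) × β => f x.1.1 x.1.2 x.2)
    (hq : ∃ q : Polynomial ℕ, ∀ x s b, size (f x s b) ≤ size s + q.eval (size x + size b)) :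
    PolyTime fun x => (l x).foldl (f x) (s x) := by
  obtain ⟨q, hq⟩ := hq
  have hfold : ∀ (x : α) (l : List β) (s : σ),
      l.foldl (fun (y : α × σ) b => (y.1, f y.1 y.2 b)) (x, s) = (x, l.foldl (f x) s) := by
    intro x l
    induction l with
    | nil => intro s; rfl
    | cons b l ih => intro s; exact ih _
  have key : ∀ (x : α) (N : ℕ) (l : List β) (s : σ), size l ≤ N →
      size (l.foldl (f x) s) ≤ size s + l.length * q.eval (size x + N) := by
    intro x N l
    induction l with
    | nil => intro s _; simp
    | cons a l ih =>
      intro s hN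
      rw [size_cons] at hN
      have h₁ := ih (f x s a) (by omega)
      have h₂ := hq x s a
      have h₃ := eval_le_eval q (show size x + size a ≤ size x + N by omega)
      rw [List.foldl_cons, List.length_cons, Nat.add_mul]
      omega
  have hf' : PolyTime fun x : (α × σ) × β => (x.1.1, f x.1.1 x.1.2 x.2) :=
    (PolyTime.fst (.fst .id)).pair hf
  have h := hf'.foldl_of_size (.X + .X * q) fun l l' y h => by
    obtain ⟨x, s⟩ := y
    rw [hfold, size_pair, size_pair]
    simp only [Polynomial.eval_add, Polynomial.eval_mul, Polynomial.eval_X]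
    have h₀ := key x (size l) l' s (size_le_of_prefix h)
    have h₁ := (length_le_size l').trans (size_le_of_prefix h)
    have h₂ := eval_le_eval q (show size x + size l ≤ size l + (size x + size s) by omega)
    have := Nat.mul_le_mul (h₁.trans (show size l ≤ size l + (size x + size s) by omega)) h₂
    omega
  have h' := (h.comp (hl.pair (PolyTime.id.pair hs))).snd
  simpa only [hfold] using h'

/-- Iteration along a list with a parameter, when no step increases the size by more than the size
of the entry of the list and a constant. -/
theorem PolyTime.foldl_of_le {l : α → List β} {s : α → σ} {f : α → σ → β → σ} (hl : PolyTime l)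
    (hs : PolyTime s) (hf : PolyTime fun x : (α × σ) × β => f x.1.1 x.1.2 x.2)
    (k : ℕ) (hq : ∀ x s b, size (f x s b) ≤ size s + size b + k) :
    PolyTime fun x => (l x).foldl (f x) (s x) :=
  hl.foldl hs hf ⟨.X + Polynomial.C k, fun x s b => (hq x s b).trans (by simp; omega)⟩

theorem size_append (l m : List α) : size (l ++ m) + 1 = size l + size m := by
  induction l with
  | nil => simp [size_nil, Nat.add_comm]
  | cons a l ih => rw [List.cons_append, size_cons, size_cons]; omega

@[fun_prop]
theorem PolyTime.reverse {l : α → List β} (hl : PolyTime l) : PolyTime fun x => (l x).reverse := by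
  have h := hl.foldl_of_le (f := fun _ s b => b :: s) (PolyTime.const ([] : List β)) (by fun_prop) 1
    fun x s b => by rw [size_cons]; omega
  have : ∀ l m : List β, l.foldl (fun s b => b :: s) m = l.reverse ++ m := by
    intro l
    induction l with
    | nil => intro m; rfl
    | cons b l ih => intro m; simp [ih]
  simpa only [this, List.append_nil] using h

@[fun_prop]
theorem PolyTime.append {l m : α → List β} (hl : PolyTime l) (hm : PolyTime m) :
    PolyTime fun x => l x ++ m x := by
  have h := hl.reverse.foldl_of_le (f := fun _ s b => b :: s) hm (by fun_prop) 1
    fun x s b => by rw [size_cons]; omega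
  simpa using h

@[fun_prop]
theorem PolyTime.flatMap {l : α → List β} {f : α → β → List γ} (hl : PolyTime l)
    (hf : PolyTime fun x : α × β => f x.1 x.2) : PolyTime fun x => (l x).flatMap (f x) := by
  obtain ⟨q, hq⟩ := hf.size_le
  have h := hl.foldl (f := fun x s b => s ++ f x b) (PolyTime.const ([] : List γ))
    (.append (by fun_prop) (hf.comp (f := fun x : (α × List γ) × β => (x.1.1, x.2)) (by fun_prop)))
    ⟨q, fun x s b => by
      have h₁ := size_append s (f x b)
      have h₂ : size (f x b) ≤ q.eval (size x + size b) := by simpa [size_pair] using hq (x, b)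
      omega⟩
  have : ∀ x (l : List β) m, l.foldl (fun s b => s ++ f x b) m = m ++ l.flatMap (f x) := by
    intro x l
    induction l with
    | nil => intro m; simp
    | cons b l ih => intro m; simp [ih]
  simpa only [this, List.nil_append] using h

@[fun_prop]
theorem PolyTime.map {l : α → List β} {f : α → β → γ} (hl : PolyTime l)
    (hf : PolyTime fun x : α × β => f x.1 x.2) : PolyTime fun x => (l x).map (f x) := by
  simpa only [List.map_eq_flatMap] using hl.flatMap (f := fun x b => [f x b]) (by fun_prop)

@[fun_prop]
theorem PolyTime.filter {l : α → List β} {p : α → β → Bool} (hl : PolyTime l)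
    (hp : PolyTime fun x : α × β => p x.1 x.2) : PolyTime fun x => (l x).filter (p x) := by
  have h := hl.flatMap (f := fun x b => if p x b = true then [b] else []) (by fun_prop)
  have : ∀ x (l : List β), l.flatMap (fun b => if p x b = true then [b] else []) =
      l.filter (p x) := by
    intro x l
    induction l with
    | nil => rfl
    | cons b l ih => rw [List.flatMap_cons, ih, List.filter_cons]; split_ifs <;> rfl
  simpa only [this] using h

@[fun_prop]
theorem PolyTime.tail {l : α → List β} (hl : PolyTime l) : PolyTime fun x => (l x).tail := by
  have h := hl.list_cases (PolyTime.const ([] : List β))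
    (g := fun y : (β × List β) × α => y.1.2) (by fun_prop)
  refine (congrArg PolyTime (funext fun x => ?_)).mp h
  cases l x <;> rfl

@[fun_prop]
theorem PolyTime.headD {l : α → List β} (hl : PolyTime l) (b : β) :
    PolyTime fun x => (l x).headD b := by
  have h := hl.list_cases (PolyTime.const b)
    (g := fun y : (β × List β) × α => y.1.1) (by fun_prop)
  refine (congrArg PolyTime (funext fun x => ?_)).mp h
  cases l x <;> rfl

@[fun_prop]
theorem PolyTime.isEmpty {l : α → List β} (hl : PolyTime l) : PolyTime fun x => (l x).isEmpty := by
  have h := hl.list_cases (PolyTime.const true)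
    (g := fun _ : (β × List β) × α => false) (by fun_prop)
  refine (congrArg PolyTime (funext fun x => ?_)).mp h
  cases l x <;> rfl

@[fun_prop]
theorem PolyTime.not {p : α → Bool} (hp : PolyTime p) : PolyTime fun x => !p x := by
  have h := hp.ite (PolyTime.const false) (PolyTime.const true)
  refine (congrArg PolyTime (funext fun x => ?_)).mp h
  cases p x <;> rfl

@[fun_prop]
theorem PolyTime.and {p q : α → Bool} (hp : PolyTime p) (hq : PolyTime q) :
    PolyTime fun x => p x && q x := by
  have h := hp.ite hq (PolyTime.const false)
  refine (congrArg PolyTime (funext fun x => ?_)).mp h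
  cases p x <;> rfl

@[fun_prop]
theorem PolyTime.or {p q : α → Bool} (hp : PolyTime p) (hq : PolyTime q) :
    PolyTime fun x => p x || q x := by
  have h := hp.ite (PolyTime.const true) hq
  refine (congrArg PolyTime (funext fun x => ?_)).mp h
  cases p x <;> rfl

@[fun_prop]
theorem PolyTime.any {l : α → List β} {p : α → β → Bool} (hl : PolyTime l)
    (hp : PolyTime fun x : α × β => p x.1 x.2) : PolyTime fun x => (l x).any (p x) := by
  have h := (hl.filter hp).isEmpty.not
  refine (congrArg PolyTime (funext fun x => ?_)).mp h
  rw [Bool.eq_iff_iff]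
  simp

@[fun_prop]
theorem PolyTime.all {l : α → List β} {p : α → β → Bool} (hl : PolyTime l)
    (hp : PolyTime fun x : α × β => p x.1 x.2) : PolyTime fun x => (l x).all (p x) := by
  have h := (hl.any (p := fun x b => !p x b) (by fun_prop)).not
  refine (congrArg PolyTime (funext fun x => ?_)).mp h
  rw [Bool.eq_iff_iff]
  simp

end polyTime

/-! ### The data types of the problem -/

section data

variable {α : Type} [Code α]

instance : DecidableEq Rel := fun a b =>
  decidable_of_iff (encRel a = encRel b)
    ⟨fun h => (readable_encRel a b [] [] (by rw [h])).1, congrArg _⟩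

theorem PolyTime.toProd_window :
    PolyTime fun w : Window => (w.points, w.rel, w.bound) :=
  .of_enc_eq fun w => (by simp [enc, encWindow, encPair])

theorem PolyTime.toProd_slice :
    PolyTime fun S : Slice => (S.rows, S.cols, S.windows) :=
  .of_enc_eq fun w => (by simp [enc, encSlice, encPair])

section projections

variable {w : α → Window} {S : α → Slice}

@[fun_prop]
theorem PolyTime.window_points (hw : PolyTime w) : PolyTime fun x => (w x).points :=
  (PolyTime.toProd_window.comp hw).fst

@[fun_prop]
theorem PolyTime.window_rel (hw : PolyTime w) : PolyTime fun x => (w x).rel :=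
  (PolyTime.toProd_window.comp hw).snd.fst

@[fun_prop]
theorem PolyTime.window_bound (hw : PolyTime w) : PolyTime fun x => (w x).bound :=
  (PolyTime.toProd_window.comp hw).snd.snd

@[fun_prop]
theorem PolyTime.slice_rows (hS : PolyTime S) : PolyTime fun x => (S x).rows :=
  (PolyTime.toProd_slice.comp hS).fst

@[fun_prop]
theorem PolyTime.slice_cols (hS : PolyTime S) : PolyTime fun x => (S x).cols :=
  (PolyTime.toProd_slice.comp hS).snd.fst

@[fun_prop]
theorem PolyTime.slice_windows (hS : PolyTime S) : PolyTime fun x => (S x).windows :=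
  (PolyTime.toProd_slice.comp hS).snd.snd

end projections

/-- The nodes of the network: a tag for the kind of node, and a point of the plane. -/
abbrev Node := ℕ × ℚ × ℚ

/-- An arc of capacity one. An arc may stand for a candidate point, which is then listed in
`points`; it is `forced` if it has to carry flow, and `used` if it carries flow at present. -/
structure Arc where
  tail : Node
  head : Node
  points : List (ℚ × ℚ)
  forced : Bool
  used : Bool
  deriving DecidableEq

/-- The components of an arc. -/
def Arc.toProd (a : Arc) : Node × Node × List (ℚ × ℚ) × Bool × Bool :=
  (a.tail, a.head, a.points, a.forced, a.used)

theorem Arc.toProd_injective : Function.Injective Arc.toProd := by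
  rintro ⟨⟩ ⟨⟩ h
  simpa [Arc.toProd] using h

instance : Code Arc where
  enc a := enc a.toProd
  readable a b u v h :=
    (readable a.toProd b.toProd u v h).imp (fun h => Arc.toProd_injective h) _root_.id
  scannable := (Code.scannable (α := Node × Node × List (ℚ × ℚ) × Bool × Bool)).comp Arc.toProd
    fun _ => rfl

theorem PolyTime.toProd_arc : PolyTime Arc.toProd := .of_enc_eq fun _ => rfl

theorem size_arc (a : Arc) : size a =
    size a.tail + (size a.head + (size a.points + (size a.forced + size a.used))) := by
  change size a.toProd = _
  simp [Arc.toProd, size_pair]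

theorem size_bool (b : Bool) : size b = 1 := rfl

section arc

variable {a : α → Arc}

@[fun_prop]
theorem PolyTime.arc_tail (ha : PolyTime a) : PolyTime fun x => (a x).tail :=
  (PolyTime.toProd_arc.comp ha).fst

@[fun_prop]
theorem PolyTime.arc_head (ha : PolyTime a) : PolyTime fun x => (a x).head :=
  (PolyTime.toProd_arc.comp ha).snd.fst

@[fun_prop]
theorem PolyTime.arc_points (ha : PolyTime a) : PolyTime fun x => (a x).points :=
  (PolyTime.toProd_arc.comp ha).snd.snd.fst

@[fun_prop]
theorem PolyTime.arc_forced (ha : PolyTime a) : PolyTime fun x => (a x).forced :=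
  (PolyTime.toProd_arc.comp ha).snd.snd.snd.fst

@[fun_prop]
theorem PolyTime.arc_used (ha : PolyTime a) : PolyTime fun x => (a x).used :=
  (PolyTime.toProd_arc.comp ha).snd.snd.snd.snd

@[fun_prop]
theorem PolyTime.arc_mk {t h : α → Node} {p : α → List (ℚ × ℚ)} {f u : α → Bool}
    (ht : PolyTime t) (hh : PolyTime h) (hp : PolyTime p) (hf : PolyTime f) (hu : PolyTime u) :
    PolyTime fun x => Arc.mk (t x) (h x) (p x) (f x) (u x) :=
  PolyTime.comp (g := fun y : Node × Node × List (ℚ × ℚ) × Bool × Bool =>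
    Arc.mk y.1 y.2.1 y.2.2.1 y.2.2.2.1 y.2.2.2.2) (.of_enc_eq fun _ => rfl)
    (f := fun x => (t x, h x, p x, f x, u x)) (by fun_prop)

end arc

/-! ### The augmentation algorithm -/

/-- The source of the residual arc that belongs to an arc. -/
def Arc.src (a : Arc) : Node := if a.used = true then a.head else a.tail

/-- The target of the residual arc that belongs to an arc. -/
def Arc.dst (a : Arc) : Node := if a.used = true then a.tail else a.head

/-- Add or remove the flow along an arc. -/
def Arc.flip (a : Arc) : Arc := ⟨a.tail, a.head, a.points, a.forced, !a.used⟩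

/-- An arc can be used in the residual network unless it is forced and carries flow already. -/
def Arc.isResidual (a : Arc) : Bool := !(a.forced && a.used)

/-- A forced arc that carries no flow. -/
def Arc.isViolated (a : Arc) : Bool := a.forced && !a.used

/-- The node `y` is `t` or the source of an arc in the list `T`. -/
def reaches (t : Node) (T : List Arc) (y : Node) : Bool :=
  decide (y = t) || T.any fun a => decide (a.src = y)

/-- Add a residual arc to the search tree if it leads from a new node to a node of the tree. -/
def extend (t : Node) (T : List Arc) (a : Arc) : List Arc :=
  if (a.isResidual && reaches t T a.dst && !reaches t T a.src) = true then a :: T else T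

/-- Try to extend the search tree by each arc once. -/
def searchRound (A : List Arc) (t : Node) (T : List Arc) : List Arc := A.foldl (extend t) T

/-- A tree of residual arcs directed towards `t`, spanning all nodes from which `t` can be reached;
the arcs that were found last come first. -/
def search (A : List Arc) (t : Node) : List Arc :=
  A.foldl (fun T _ => searchRound A t T) (searchRound A t [])

/-- Flip the first occurrence of an arc in a list. -/
def flipIn (a : Arc) : List Arc → List Arc
  | [] => []
  | b :: l => if b = a then b.flip :: l else b :: flipIn a l

/-- Follow the search tree `T` from a node, flipping the arcs that are passed. Since every arc of
the tree leads to an arc further down in the list, one pass through the list suffices. -/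
def walk (T : List Arc) (s : Node × List Arc) : Node × List Arc :=
  T.foldl (fun s a => if decide (a.src = s.1) = true then (a.dst, flipIn a s.2) else s) s

/-- Send flow around a residual cycle through the first violated arc, if there is such a cycle. -/
def augment (A : List Arc) : List Arc :=
  match A.filter Arc.isViolated with
  | [] => A
  | e :: _ => if reaches e.tail (search A e.tail) e.head = true then
      (walk (search A e.tail) (e.head, flipIn e A)).2 else A

/-- Augment as often as there are arcs. -/
def optimize (A : List Arc) : List Arc := A.foldl (fun B _ => augment B) A

theorem size_flipIn (a : Arc) (A : List Arc) : size (flipIn a A) = size A := by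
  induction A with
  | nil => rfl
  | cons b l ih =>
    rw [flipIn]
    split_ifs
    · simp [size_cons, size_arc, size_bool, Arc.flip]
    · simp [size_cons, ih]

theorem size_walk (T : List Arc) (s : Node × List Arc) : size (walk T s).2 = size s.2 := by
  induction T generalizing s with
  | nil => rfl
  | cons a T ih =>
    rw [walk, List.foldl_cons, ← walk, ih]
    split_ifs
    · exact size_flipIn _ _
    · rfl

theorem size_augment (A : List Arc) : size (augment A) = size A := by
  unfold augment
  split
  · rfl
  · split_ifs
    · rw [size_walk, size_flipIn]
    · rfl

section algorithm

variable {a : α → Arc} {A T : α → List Arc} {t y : α → Node}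

@[fun_prop]
theorem PolyTime.src (ha : PolyTime a) : PolyTime fun x => (a x).src := by
  unfold Arc.src; fun_prop

@[fun_prop]
theorem PolyTime.dst (ha : PolyTime a) : PolyTime fun x => (a x).dst := by
  unfold Arc.dst; fun_prop

@[fun_prop]
theorem PolyTime.flip (ha : PolyTime a) : PolyTime fun x => (a x).flip := by
  unfold Arc.flip; fun_prop

@[fun_prop]
theorem PolyTime.isResidual (ha : PolyTime a) : PolyTime fun x => (a x).isResidual := by
  unfold Arc.isResidual; fun_prop

@[fun_prop]
theorem PolyTime.isViolated (ha : PolyTime a) : PolyTime fun x => (a x).isViolated := by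
  unfold Arc.isViolated; fun_prop

@[fun_prop]
theorem PolyTime.reaches (ht : PolyTime t) (hT : PolyTime T) (hy : PolyTime y) :
    PolyTime fun x => reaches (t x) (T x) (y x) := by
  unfold WindowTomography.reaches; fun_prop

@[fun_prop]
theorem PolyTime.extend (ht : PolyTime t) (hT : PolyTime T) (ha : PolyTime a) :
    PolyTime fun x => extend (t x) (T x) (a x) := by
  unfold WindowTomography.extend; fun_prop

theorem size_extend_le (t : Node) (T : List Arc) (a : Arc) :
    size (extend t T a) ≤ size T + size a + 1 := by
  rw [extend]
  split_ifs
  · rw [size_cons]; omega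
  · omega

@[fun_prop]
theorem PolyTime.searchRound (hA : PolyTime A) (ht : PolyTime t) (hT : PolyTime T) :
    PolyTime fun x => searchRound (A x) (t x) (T x) :=
  hA.foldl_of_le (f := fun x T a => WindowTomography.extend (t x) T a) hT (by fun_prop) 1
    fun x T a => size_extend_le _ _ _

theorem size_searchRound_le (A : List Arc) (t : Node) (T : List Arc) :
    size (searchRound A t T) ≤ size T + size A := by
  induction A generalizing T with
  | nil => exact Nat.le_add_right _ _
  | cons a A ih =>
    rw [searchRound, List.foldl_cons, ← searchRound, size_cons]
    have := ih (extend t T a)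
    have := size_extend_le t T a
    omega

@[fun_prop]
theorem PolyTime.search (hA : PolyTime A) (ht : PolyTime t) :
    PolyTime fun x => search (A x) (t x) := by
  obtain ⟨q, hq⟩ := hA.size_le
  refine hA.foldl (f := fun x T _ => WindowTomography.searchRound (A x) (t x) T) (by fun_prop)
    (by fun_prop) ⟨q, fun x T a => (size_searchRound_le _ _ _).trans ?_⟩
  have := hq x
  have := eval_le_eval q (Nat.le_add_right (size x) (size a))
  omega

@[fun_prop]
theorem PolyTime.flipIn (ha : PolyTime a) (hA : PolyTime A) :
    PolyTime fun x => flipIn (a x) (A x) := by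
  -- The state consists of a flag, which is set once the arc has been found, and of the arcs that
  -- have been passed, in reverse order.
  let f : α → Bool × List Arc → Arc → Bool × List Arc := fun x s b =>
    if (!s.1 && decide (b = a x)) = true then (true, b.flip :: s.2) else (s.1, b :: s.2)
  have h := hA.foldl_of_le (f := f) (PolyTime.const (false, [])) (by simp only [f]; fun_prop) 1
    fun x s b => by
      simp only [f]
      split_ifs
      · simp [size_pair, size_cons, size_arc, size_bool, Arc.flip]; omega
      · simp [size_pair, size_cons]; omega
  have h₁ : ∀ (x : α) (l m : List Arc), (l.foldl (f x) (true, m)).2.reverse = m.reverse ++ l := by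
    intro x l
    induction l with
    | nil => simp
    | cons b l ih =>
      intro m
      rw [List.foldl_cons, show f x (true, m) b = (true, b :: m) by simp [f], ih]
      simp
  have h₂ : ∀ (x : α) (l m : List Arc), (l.foldl (f x) (false, m)).2.reverse =
      m.reverse ++ WindowTomography.flipIn (a x) l := by
    intro x l
    induction l with
    | nil => simp [WindowTomography.flipIn]
    | cons b l ih =>
      intro m
      rw [List.foldl_cons, WindowTomography.flipIn]
      by_cases hb : b = a x
      · rw [show f x (false, m) b = (true, b.flip :: m) by simp [f, hb], h₁]
        simp [hb]
      · rw [show f x (false, m) b = (false, b :: m) by simp [f, hb], ih]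
        simp [hb]
  simpa [h₂] using h.snd.reverse

@[fun_prop]
theorem PolyTime.walk {s : α → Node × List Arc} (hT : PolyTime T) (hs : PolyTime s) :
    PolyTime fun x => walk (T x) (s x) := by
  let f : Node × List Arc → Arc → Node × List Arc := fun s a =>
    if decide (a.src = s.1) = true then (a.dst, WindowTomography.flipIn a s.2) else s
  have hf : PolyTime fun x : (α × (Node × List Arc)) × Arc => f x.1.2 x.2 := by
    simp only [f]; fun_prop
  have hsize : ∀ (x : α) s a, size (f s a) ≤ size s + size a + 0 := fun _ s a => by
    have h₀ : size a.dst ≤ size a := by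
      rw [Arc.dst, size_arc]
      split_ifs <;> omega
    have h₁ : size (a.dst, WindowTomography.flipIn a s.2) = size a.dst + size s.2 := by
      rw [size_pair, size_flipIn]
    have h₂ := size_pair s
    simp only [f]
    split_ifs <;> omega
  exact hT.foldl_of_le (f := fun _ => f) hs hf 0 hsize

@[fun_prop]
theorem PolyTime.augment (hA : PolyTime A) : PolyTime fun x => augment (A x) := by
  have h := (PolyTime.list_cases (l := fun A : List Arc => A.filter Arc.isViolated)
    (f := fun A => A)
    (g := fun y : (Arc × List Arc) × List Arc =>
      if WindowTomography.reaches y.1.1.tail (WindowTomography.search y.2 y.1.1.tail)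
        y.1.1.head = true then
      (WindowTomography.walk (WindowTomography.search y.2 y.1.1.tail)
        (y.1.1.head, WindowTomography.flipIn y.1.1 y.2)).2 else y.2)
    (by fun_prop) (by fun_prop) (by fun_prop)).comp hA
  refine (congrArg PolyTime (funext fun x => ?_)).mp h
  unfold WindowTomography.augment
  cases (A x).filter Arc.isViolated <;> rfl

@[fun_prop]
theorem PolyTime.optimize (hA : PolyTime A) : PolyTime fun x => optimize (A x) :=
  hA.foldl_of_le (f := fun _ B _ => WindowTomography.augment B) hA (by fun_prop) 0
    fun x B a => by rw [size_augment]; omega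

end algorithm

end data

/-! ### Unary numbers -/

/-- Truncated subtraction of unary numbers. -/
def monus (u v : List Unit) : List Unit := v.foldl (fun s _ => s.tail) u

theorem length_monus (u v : List Unit) : (monus u v).length = u.length - v.length := by
  induction v generalizing u with
  | nil => rfl
  | cons x v ih =>
    rw [monus, List.foldl_cons, ← monus, ih, List.length_tail, List.length_cons]
    omega

/-- The unary representation of the minimum of a number and the length of `U`. -/
def cap (U : List Unit) (n : ℕ) : List Unit :=
  n.bits.reverse.foldl
    (fun s b => monus U (monus U (s ++ s ++ if b = true then [()] else []))) []

theorem length_cap (U : List Unit) (n : ℕ) : (cap U n).length = min n U.length := by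
  induction n using Nat.binaryRec' with
  | zero => simp [cap]
  | bit b n hn ih =>
    rw [cap, Nat.bits_append_bit n b hn, List.reverse_cons, List.foldl_append, ← cap]
    cases b <;> simp [length_monus, ih, Nat.bit] <;> omega

theorem size_unary (u : List Unit) : size u = u.length + 1 := by
  induction u with
  | nil => rfl
  | cons x u ih => rw [size_cons, ih, List.length_cons, show size x = 0 from rfl]; omega

section unary

variable {α : Type} [Code α]

@[fun_prop]
theorem PolyTime.monus {u v : α → List Unit} (hu : PolyTime u) (hv : PolyTime v) :
    PolyTime fun x => monus (u x) (v x) :=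
  hv.foldl_of_le (f := fun (_ : α) (s : List Unit) (_ : Unit) => s.tail) hu
    (by fun_prop) 0 fun x s b => by
    simp only [size_unary, List.length_tail]; omega

@[fun_prop]
theorem PolyTime.cap {U : α → List Unit} {n : α → ℕ} (hU : PolyTime U) (hn : PolyTime n) :
    PolyTime fun x => cap (U x) (n x) := by
  obtain ⟨q, hq⟩ := hU.size_le
  have hb : PolyTime fun x => (n x).bits := PolyTime.bits.comp hn
  refine hb.reverse.foldl (f := fun x s b => WindowTomography.monus (U x)
    (WindowTomography.monus (U x) (s ++ s ++ if b = true then [()] else []))) (by fun_prop)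
    (by fun_prop) ⟨q, fun x s b => ?_⟩
  have h₁ := hq x
  have h₂ := eval_le_eval q (Nat.le_add_right (size x) (size b))
  simp only [size_unary, length_monus] at h₁ ⊢
  omega

end unary

/-! ### The network of a slice -/

/-- The node through which all flow passes. -/
def root : Node := (0, 0, 0)

/-- The node of the line with second coordinate `y`. -/
def rowNode (y : ℚ) : Node := (1, 0, y)

/-- The node of a horizontal window with first point `p`. -/
def horNode (p : ℚ × ℚ) : Node := (2, p)

/-- The node of the line with first coordinate `x`. -/
def colNode (x : ℚ) : Node := (3, x, 0)

/-- The node of a vertical window with first point `p`. -/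
def verNode (p : ℚ × ℚ) : Node := (4, p)

/-- The first point of a window. -/
def Window.anchor (w : Window) : ℚ × ℚ := w.points.headD (0, 0)

/-- The points of a window lie in a horizontal line. -/
def Window.isHorizontal (w : Window) : Bool := w.points.all fun p => decide (p.2 = w.anchor.2)

/-- The arc of a window runs from a row to a horizontal window or from a vertical window to a
column; this is its tail. -/
def Window.tail (w : Window) : Node :=
  if w.isHorizontal = true then rowNode w.anchor.2 else verNode w.anchor

/-- The head of the arc of a window. -/
def Window.head (w : Window) : Node :=
  if w.isHorizontal = true then horNode w.anchor else colNode w.anchor.1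

/-- The least number of points that a window has to contain, cut off at the length of `U`. -/
def Window.lower (U : List Unit) (w : Window) : List Unit :=
  if decide (w.rel = .le) = true then [] else cap U w.bound

/-- The largest number of points that a window may contain, cut off at the length of `U`. -/
def Window.upper (U : List Unit) (w : Window) : List Unit :=
  if decide (w.rel = .ge) = true then U else cap U w.bound

/-- Parallel arcs that together carry at least `lo` and at most `hi` units of flow. -/
def bundle (t h : Node) (lo hi : List Unit) : List Arc :=
  lo.map (fun _ => ⟨t, h, [], true, false⟩) ++
    (monus hi lo).map (fun _ => ⟨t, h, [], false, false⟩)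

/-- The candidate points. -/
def Slice.points (S : Slice) : List (ℚ × ℚ) :=
  S.cols.flatMap fun c => S.rows.map fun r => (c.1, r.1)

/-- A unary number larger than the number of candidate points. -/
def Slice.big (S : Slice) : List Unit := () :: S.points.map fun _ => ()

/-- The node from which a point receives flow: the horizontal window that contains it, if there is
one, and otherwise its row. -/
def Slice.source (S : Slice) (p : ℚ × ℚ) : Node :=
  ((S.windows.filter fun w => w.isHorizontal && w.points.any fun q => decide (q = p)).map
    (fun w => horNode w.anchor) ++ [rowNode p.2]).headD root

/-- The node to which a point sends flow: the vertical window that contains it, if there is one,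
and otherwise its column. -/
def Slice.target (S : Slice) (p : ℚ × ℚ) : Node :=
  ((S.windows.filter fun w => !w.isHorizontal && w.points.any fun q => decide (q = p)).map
    (fun w => verNode w.anchor) ++ [colNode p.1]).headD root

/-- The network of a slice. -/
def Slice.arcs (S : Slice) : List Arc :=
  (S.rows.flatMap (fun e => bundle root (rowNode e.1) (cap S.big e.2) (cap S.big e.2)) ++
    (S.cols.flatMap (fun e => bundle (colNode e.1) root (cap S.big e.2) (cap S.big e.2)) ++
      S.windows.flatMap (fun w => bundle w.tail w.head (w.lower S.big) (w.upper S.big)))) ++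
    S.points.map fun p => ⟨S.source p, S.target p, [p], false, false⟩

/-- The points whose arcs carry flow. -/
def usedPoints (A : List Arc) : List (ℚ × ℚ) :=
  A.flatMap fun a => if a.used = true then a.points else []

/-- A list with a solution as its only entry, or an empty list if there is no solution. -/
def Slice.solve (S : Slice) : List (List (ℚ × ℚ)) :=
  if ((optimize S.arcs).any Arc.isViolated) = true then [] else [usedPoints (optimize S.arcs)]

/-- The answer to an instance. -/
def Instance.solve (I : Instance) : Option (List (List (ℚ × ℚ))) :=
  if (I.all fun S => !S.solve.isEmpty) = true then some (I.flatMap Slice.solve) else none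

section network

variable {α : Type} [Code α] {w : α → Window} {S : α → Slice} {U : α → List Unit}
  {p : α → ℚ × ℚ} {q : α → ℚ}

@[fun_prop]
theorem PolyTime.rowNode (hq : PolyTime q) : PolyTime fun x => rowNode (q x) := by
  unfold WindowTomography.rowNode; fun_prop

@[fun_prop]
theorem PolyTime.colNode (hq : PolyTime q) : PolyTime fun x => colNode (q x) := by
  unfold WindowTomography.colNode; fun_prop

@[fun_prop]
theorem PolyTime.horNode (hp : PolyTime p) : PolyTime fun x => horNode (p x) := by
  unfold WindowTomography.horNode; fun_prop

@[fun_prop]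
theorem PolyTime.verNode (hp : PolyTime p) : PolyTime fun x => verNode (p x) := by
  unfold WindowTomography.verNode; fun_prop

@[fun_prop]
theorem PolyTime.anchor (hw : PolyTime w) : PolyTime fun x => (w x).anchor := by
  unfold Window.anchor; fun_prop

@[fun_prop]
theorem PolyTime.isHorizontal (hw : PolyTime w) : PolyTime fun x => (w x).isHorizontal := by
  unfold Window.isHorizontal; fun_prop

@[fun_prop]
theorem PolyTime.window_tail (hw : PolyTime w) : PolyTime fun x => (w x).tail := by
  unfold Window.tail; fun_prop

@[fun_prop]
theorem PolyTime.window_head (hw : PolyTime w) : PolyTime fun x => (w x).head := by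
  unfold Window.head; fun_prop

@[fun_prop]
theorem PolyTime.lower (hU : PolyTime U) (hw : PolyTime w) :
    PolyTime fun x => (w x).lower (U x) := by
  unfold Window.lower; fun_prop

@[fun_prop]
theorem PolyTime.upper (hU : PolyTime U) (hw : PolyTime w) :
    PolyTime fun x => (w x).upper (U x) := by
  unfold Window.upper; fun_prop

@[fun_prop]
theorem PolyTime.bundle {t h : α → Node} {lo hi : α → List Unit} (ht : PolyTime t)
    (hh : PolyTime h) (hlo : PolyTime lo) (hhi : PolyTime hi) :
    PolyTime fun x => bundle (t x) (h x) (lo x) (hi x) := by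
  unfold WindowTomography.bundle; fun_prop

@[fun_prop]
theorem PolyTime.slice_points (hS : PolyTime S) : PolyTime fun x => (S x).points := by
  unfold Slice.points; fun_prop

@[fun_prop]
theorem PolyTime.big (hS : PolyTime S) : PolyTime fun x => (S x).big := by
  unfold Slice.big; fun_prop

@[fun_prop]
theorem PolyTime.source (hS : PolyTime S) (hp : PolyTime p) :
    PolyTime fun x => (S x).source (p x) := by
  unfold Slice.source; fun_prop

@[fun_prop]
theorem PolyTime.target (hS : PolyTime S) (hp : PolyTime p) :
    PolyTime fun x => (S x).target (p x) := by
  unfold Slice.target; fun_prop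

@[fun_prop]
theorem PolyTime.arcs (hS : PolyTime S) : PolyTime fun x => (S x).arcs := by
  unfold Slice.arcs; fun_prop

@[fun_prop]
theorem PolyTime.usedPoints {A : α → List Arc} (hA : PolyTime A) :
    PolyTime fun x => usedPoints (A x) := by
  unfold WindowTomography.usedPoints; fun_prop

@[fun_prop]
theorem PolyTime.slice_solve (hS : PolyTime S) : PolyTime fun x => (S x).solve := by
  unfold Slice.solve; fun_prop

theorem PolyTime.instance_solve : PolyTime Instance.solve := by
  unfold Instance.solve; fun_prop

end network

/-! ### Circulations and residual cycles -/

/-- The contribution of an arc to the pairing of the flow with the coboundary of a potential. -/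
def Arc.val (h : Node → ℤ) (a : Arc) : ℤ := if a.used = true then h a.tail - h a.head else 0

/-- The flow is conserved at each node; equivalently, it pairs to zero with each potential. -/
def IsCirculation (A : List Arc) : Prop := ∀ h : Node → ℤ, (A.map (Arc.val h)).sum = 0

/-- The arc without its flow. -/
def Arc.base (a : Arc) : Arc := ⟨a.tail, a.head, a.points, a.forced, false⟩

theorem Arc.base_flip (a : Arc) : a.flip.base = a.base := rfl

theorem Arc.val_flip (h : Node → ℤ) (a : Arc) : a.flip.val h = a.val h + (h a.src - h a.dst) := by
  obtain ⟨t, h', p, f, u⟩ := a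
  cases u <;> simp [Arc.val, Arc.flip, Arc.src, Arc.dst]

theorem sum_flipIn (h : Node → ℤ) {a : Arc} {A : List Arc} (ha : a ∈ A) :
    ((flipIn a A).map (Arc.val h)).sum = (A.map (Arc.val h)).sum + (h a.src - h a.dst) := by
  induction A with
  | nil => simp at ha
  | cons b A ih =>
    rw [flipIn]
    split_ifs with hb
    · subst hb
      simp only [List.map_cons, List.sum_cons, Arc.val_flip]
      ring
    · rw [List.map_cons, List.sum_cons, ih (by simpa [Ne.symm hb] using ha), List.map_cons,
        List.sum_cons]
      ring

theorem map_base_flipIn (a : Arc) (A : List Arc) : (flipIn a A).map Arc.base = A.map Arc.base := by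
  induction A with
  | nil => rfl
  | cons b A ih =>
    rw [flipIn]
    split_ifs
    · simp [Arc.base_flip]
    · simp [ih]

theorem mem_flipIn {a b : Arc} {A : List Arc} (hb : b ∈ A) (h : b ≠ a) : b ∈ flipIn a A := by
  induction A with
  | nil => exact hb
  | cons c A ih =>
    rw [flipIn]
    rcases List.mem_cons.1 hb with rfl | hb
    · rw [if_neg h]; exact List.mem_cons_self
    · split_ifs
      · exact List.mem_cons_of_mem _ hb
      · exact List.mem_cons_of_mem _ (ih hb)

/-- Flipping a residual arc creates no violation. -/
theorem countP_flipIn_le {a : Arc} (ha : a.isResidual = true) (A : List Arc) :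
    (flipIn a A).countP Arc.isViolated ≤ A.countP Arc.isViolated := by
  induction A with
  | nil => exact le_rfl
  | cons b A ih =>
    rw [flipIn]
    split_ifs with hb
    · subst hb
      have : b.flip.isViolated = false := by
        cases hf : b.forced <;> cases hu : b.used <;>
          simp_all [Arc.isResidual, Arc.isViolated, Arc.flip]
      simp [List.countP_cons, this]
    · simp only [List.countP_cons]; omega

theorem countP_flipIn_lt {a : Arc} (ha : a.isViolated = true) {A : List Arc} (hA : a ∈ A) :
    (flipIn a A).countP Arc.isViolated < A.countP Arc.isViolated := by
  induction A with
  | nil => simp at hA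
  | cons b A ih =>
    rw [flipIn]
    split_ifs with hb
    · subst hb
      have : b.flip.isViolated = false := by
        have : b.forced = true ∧ b.used = false := by simpa [Arc.isViolated] using ha
        simp [Arc.isViolated, Arc.flip, this]
      simp [this, ha]
    · have := ih (by simpa [Ne.symm hb] using hA)
      simp only [List.countP_cons]; omega

/-! ### The search tree -/

theorem reaches_iff {t y : Node} {T : List Arc} :
    reaches t T y = true ↔ y = t ∨ ∃ a ∈ T, a.src = y := by
  simp [reaches]

/-- Each arc of `T` is residual and leads from a new node to `t` or to the source of an arc further
down in the list. -/
def IsTree (t : Node) : List Arc → Prop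
  | [] => True
  | a :: T => (a.isResidual = true ∧ reaches t T a.dst = true ∧ ¬ reaches t T a.src = true) ∧
      IsTree t T

theorem IsTree.src_ne {t : Node} {T : List Arc} (hT : IsTree t T) {a : Arc} (ha : a ∈ T) :
    a.src ≠ t := by
  induction T with
  | nil => simp at ha
  | cons b T ih =>
    rcases List.mem_cons.1 ha with rfl | ha
    · exact fun h => hT.1.2.2 (reaches_iff.2 (.inl h))
    · exact ih hT.2 ha

theorem IsTree.nodup {t : Node} {T : List Arc} (hT : IsTree t T) : T.Nodup := by
  induction T with
  | nil => exact List.nodup_nil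
  | cons b T ih =>
    exact List.nodup_cons.2 ⟨fun h => hT.1.2.2 (reaches_iff.2 (.inr ⟨b, h, rfl⟩)), ih hT.2⟩

theorem IsTree.extend {t : Node} {T : List Arc} (hT : IsTree t T) (a : Arc) :
    IsTree t (extend t T a) := by
  rw [WindowTomography.extend]
  split_ifs with h
  · simp only [Bool.and_eq_true, Bool.not_eq_true'] at h
    exact ⟨⟨h.1.1, h.1.2, by simp [h.2]⟩, hT⟩
  · exact hT

theorem suffix_extend (t : Node) (T : List Arc) (a : Arc) : T <:+ extend t T a := by
  rw [extend]
  split_ifs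
  · exact List.suffix_cons _ _
  · exact List.suffix_rfl

theorem mem_extend {t : Node} {T : List Arc} {a b : Arc} (h : b ∈ extend t T a) :
    b = a ∨ b ∈ T := by
  rw [extend] at h
  split_ifs at h
  · exact List.mem_cons.1 h
  · exact .inr h

theorem reaches_of_suffix {t y : Node} {T T' : List Arc} (h : T <:+ T')
    (hy : reaches t T y = true) : reaches t T' y = true := by
  rw [reaches_iff] at hy ⊢
  exact hy.imp_right fun ⟨a, ha, h'⟩ => ⟨a, h.subset ha, h'⟩

theorem IsTree.searchRound {t : Node} {T : List Arc} (hT : IsTree t T) (A : List Arc) :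
    IsTree t (searchRound A t T) := by
  induction A generalizing T with
  | nil => exact hT
  | cons a A ih => exact ih (hT.extend a)

theorem suffix_searchRound (A : List Arc) (t : Node) (T : List Arc) :
    T <:+ searchRound A t T := by
  induction A generalizing T with
  | nil => exact List.suffix_rfl
  | cons a A ih => exact (suffix_extend t T a).trans (ih _)

theorem mem_searchRound {A : List Arc} {t : Node} {T : List Arc} {b : Arc}
    (h : b ∈ searchRound A t T) : b ∈ A ∨ b ∈ T := by
  induction A generalizing T with
  | nil => exact .inr h
  | cons a A ih =>
    rcases ih h with h | h
    · exact .inl (List.mem_cons_of_mem _ h)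
    · exact (mem_extend h).imp_left fun h => by simp [h]

/-- No residual arc leads from a node that is not reached to a node that is reached. -/
def IsClosed (A : List Arc) (t : Node) (T : List Arc) : Prop :=
  ∀ a ∈ A, a.isResidual = true → reaches t T a.dst = true → reaches t T a.src = true

theorem reaches_searchRound {A : List Arc} {t : Node} {T : List Arc} {a : Arc} (ha : a ∈ A)
    (hr : a.isResidual = true) (h : reaches t T a.dst = true) :
    reaches t (searchRound A t T) a.src = true := by
  induction A generalizing T with
  | nil => simp at ha
  | cons b A ih =>
    rcases List.mem_cons.1 ha with rfl | ha
    · refine reaches_of_suffix (suffix_searchRound A t _) ?_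
      by_cases hs : reaches t T a.src = true
      · exact reaches_of_suffix (suffix_extend t T a) hs
      · rw [extend, if_pos (by simp [hr, h, hs]), reaches_iff]
        exact .inr ⟨a, List.mem_cons_self, rfl⟩
    · exact ih ha (reaches_of_suffix (suffix_extend t T b) h)

theorem IsClosed.searchRound_eq {A : List Arc} {t : Node} {T : List Arc} (h : IsClosed A t T) :
    searchRound A t T = T := by
  suffices ∀ B ⊆ A, searchRound B t T = T from this A (List.Subset.refl A)
  intro B hB
  induction B with
  | nil => rfl
  | cons a B ih =>
    have ha := h a (hB List.mem_cons_self)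
    have : extend t T a = T := by
      rw [extend, if_neg]
      simp only [Bool.and_eq_true, Bool.not_eq_true', not_and, Bool.not_eq_false, and_imp]
      exact ha
    rw [searchRound, List.foldl_cons, this]
    exact ih fun b hb => hB (List.mem_cons_of_mem _ hb)

/-- A round of the search either adds an arc or finds that the search is finished. -/
theorem isClosed_or_length_le (A : List Arc) (t : Node) (l : List Arc) (T : List Arc) :
    IsClosed A t (l.foldl (fun T _ => searchRound A t T) T) ∨
      T.length + l.length ≤ (l.foldl (fun T _ => searchRound A t T) T).length := by
  induction l generalizing T with
  | nil => exact .inr le_rfl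
  | cons a l ih =>
    have hs := suffix_searchRound A t T
    rcases hs.length_le.eq_or_lt with h | h
    · have hT := hs.eq_of_length h
      have hc : IsClosed A t T := fun a ha hr h => by
        rw [hT]; exact reaches_searchRound ha hr h
      left
      have : ∀ m : List Arc, m.foldl (fun T _ => searchRound A t T) T = T := by
        intro m
        induction m with
        | nil => rfl
        | cons b m ih => rw [List.foldl_cons, hc.searchRound_eq, ih]
      rwa [this]
    · refine (ih (searchRound A t T)).imp_right fun h' => ?_
      rw [List.foldl_cons, List.length_cons]
      omega

theorem search_spec (A : List Arc) (t : Node) : IsTree t (search A t) ∧ search A t ⊆ A := by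
  have : ∀ (l T : List Arc), IsTree t T → T ⊆ A →
      IsTree t (l.foldl (fun T _ => searchRound A t T) T) ∧
        l.foldl (fun T _ => searchRound A t T) T ⊆ A := by
    intro l
    induction l with
    | nil => exact fun T h h' => ⟨h, h'⟩
    | cons a l ih =>
      exact fun T h h' => ih _ (h.searchRound A) fun b hb =>
        (mem_searchRound hb).elim _root_.id (h' ·)
  refine this A _ (IsTree.searchRound (T := []) trivial A) fun b hb => ?_
  simpa using mem_searchRound hb

theorem isClosed_search (A : List Arc) (t : Node) : IsClosed A t (search A t) := by
  cases hA : A with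
  | nil => intro a ha; simp at ha
  | cons a B =>
    rw [← hA]
    -- There are more rounds than arcs.
    refine (isClosed_or_length_le A t (a :: A) []).resolve_right fun h => ?_
    have h' := (List.subperm_of_subset (search_spec A t).1.nodup (search_spec A t).2).length_le
    change _ ≤ (search A t).length at h
    simp at h
    omega

/-! ### Correctness of the augmentation algorithm -/

theorem walk_spec {t : Node} {T : List Arc} (hT : IsTree t T) {y : Node} {A : List Arc}
    (hA : T ⊆ A) (hy : reaches t T y = true) :
    (walk T (y, A)).2.map Arc.base = A.map Arc.base ∧
    (∀ h : Node → ℤ, ((walk T (y, A)).2.map (Arc.val h)).sum =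
      (A.map (Arc.val h)).sum + (h y - h t)) ∧
    (walk T (y, A)).2.countP Arc.isViolated ≤ A.countP Arc.isViolated := by
  induction T generalizing y A with
  | nil =>
    obtain rfl : y = t := by simpa [reaches_iff] using hy
    simp [walk]
  | cons a T ih =>
    rw [walk, List.foldl_cons, ← walk]
    by_cases ha : a.src = y
    · rw [if_pos (by simpa using ha)]
      obtain ⟨h₁, h₂, h₃⟩ := ih hT.2 (A := flipIn a A) (y := a.dst)
        (fun b hb => mem_flipIn (hA (List.mem_cons_of_mem _ hb))
          fun hba => hT.1.2.2 (reaches_iff.2 (.inr ⟨b, hb, by rw [hba]⟩))) hT.1.2.1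
      refine ⟨h₁.trans (map_base_flipIn a A), fun h => ?_, h₃.trans (countP_flipIn_le hT.1.1 A)⟩
      rw [h₂, sum_flipIn h (hA List.mem_cons_self), ha]
      ring
    · rw [if_neg (by simpa using ha)]
      refine ih hT.2 (fun b hb => hA (List.mem_cons_of_mem _ hb)) ?_
      rw [reaches_iff] at hy ⊢
      simpa [ha] using hy

/-- Some circulation on the same network carries flow on all forced arcs. -/
def IsFeasible (A : List Arc) : Prop :=
  ∃ B : List Arc, B.map Arc.base = A.map Arc.base ∧ IsCirculation B ∧
    ∀ b ∈ B, b.forced = true → b.used = true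

/-- If no residual path closes up the violated arc `e`, then the nodes that are reached form a cut
which no circulation can cross as required. -/
theorem reaches_of_isFeasible {A : List Arc} (hA : IsCirculation A) (hf : IsFeasible A) {e : Arc}
    (he : e ∈ A) (hv : e.isViolated = true) :
    reaches e.tail (search A e.tail) e.head = true := by
  by_contra hn
  obtain ⟨B, hB, hBc, hBf⟩ := hf
  have hcl := isClosed_search A e.tail
  generalize search A e.tail = T at hn hcl
  let h : Node → ℤ := fun y => if reaches e.tail T y = true then 1 else 0
  -- The least contribution of an arc under any admissible choice of its flow.
  let φ : Arc → ℤ := fun a =>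
    if a.forced = true then h a.tail - h a.head else min (h a.tail - h a.head) 0
  have hφ : ∀ a, φ a.base = φ a := fun _ => rfl
  have hsum : (A.map φ).sum = (B.map φ).sum := by
    have := congrArg (fun l : List Arc => (l.map φ).sum) hB
    simpa [List.map_map, Function.comp_def, hφ] using this.symm
  have hle : ∀ a ∈ A, a.val h ≤ φ a := by
    intro a ha
    have := hcl a ha
    obtain ⟨t, s, p, f, u⟩ := a
    simp only [Arc.isResidual, Arc.src, Arc.dst] at this
    cases f <;> cases u <;> simp [Arc.val, φ, h] at this ⊢ <;> split_ifs <;> simp_all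
  have hlt : e.val h < φ e := by
    have hr : reaches e.tail T e.tail = true := reaches_iff.2 (.inl rfl)
    have hfu : e.forced = true ∧ e.used = false := by simpa [Arc.isViolated] using hv
    simp [Arc.val, φ, h, hfu, hr, hn]
  have h₁ : (A.map (Arc.val h)).sum < (A.map φ).sum :=
    List.sum_lt_sum _ _ hle ⟨e, he, hlt⟩
  have h₂ : (B.map φ).sum ≤ (B.map (Arc.val h)).sum := by
    refine List.sum_le_sum fun b hb => ?_
    have := hBf b hb
    simp only [Arc.val, φ]
    split_ifs <;> simp_all
  rw [hA h, hsum] at h₁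
  rw [hBc h] at h₂
  omega

theorem augment_spec (A : List Arc) :
    (augment A).map Arc.base = A.map Arc.base ∧
    (IsCirculation A → IsCirculation (augment A)) ∧
    (IsCirculation A → IsFeasible A →
      (augment A).countP Arc.isViolated ≤ A.countP Arc.isViolated - 1) := by
  unfold augment
  split
  · next h =>
    refine ⟨rfl, _root_.id, fun _ _ => ?_⟩
    rw [List.countP_eq_length_filter, h]
    rfl
  · next e l h =>
    have he : e ∈ A ∧ e.isViolated = true := by
      rw [← List.mem_filter, h]; exact List.mem_cons_self
    have hfu : e.forced = true ∧ e.used = false := by simpa [Arc.isViolated] using he.2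
    have hsrc : e.src = e.tail := by simp [Arc.src, hfu]
    have hdst : e.dst = e.head := by simp [Arc.dst, hfu]
    obtain ⟨hT, hTA⟩ := search_spec A e.tail
    split_ifs with hr
    · obtain ⟨h₁, h₂, h₃⟩ := walk_spec hT (A := flipIn e A) (fun b hb => mem_flipIn (hTA hb)
        fun hbe => hT.src_ne hb (by rw [hbe, hsrc])) hr
      refine ⟨h₁.trans (map_base_flipIn e A), fun hA h => ?_, fun _ _ => ?_⟩
      · rw [h₂, sum_flipIn h he.1, hA h, hsrc, hdst]
        ring
      · have := countP_flipIn_lt he.2 he.1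
        omega
    · exact ⟨rfl, _root_.id, fun hA hf => absurd (reaches_of_isFeasible hA hf he.1 he.2) hr⟩

theorem optimize_spec {A : List Arc} (hA : IsCirculation A) :
    (optimize A).map Arc.base = A.map Arc.base ∧ IsCirculation (optimize A) ∧
      (IsFeasible A → ∀ a ∈ optimize A, ¬ a.isViolated = true) := by
  have key : ∀ (l B : List Arc), IsCirculation B →
      (l.foldl (fun B _ => augment B) B).map Arc.base = B.map Arc.base ∧
      IsCirculation (l.foldl (fun B _ => augment B) B) ∧
      (IsFeasible B → (l.foldl (fun B _ => augment B) B).countP Arc.isViolated ≤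
        B.countP Arc.isViolated - l.length) := by
    intro l
    induction l with
    | nil => exact fun B hB => ⟨rfl, hB, fun _ => le_rfl⟩
    | cons a l ih =>
      intro B hB
      obtain ⟨h₁, h₂, h₃⟩ := augment_spec B
      obtain ⟨h₁', h₂', h₃'⟩ := ih _ (h₂ hB)
      refine ⟨h₁'.trans h₁, h₂', fun hf => ?_⟩
      have := h₃ hB hf
      have := h₃' (by unfold IsFeasible; rw [h₁]; exact hf)
      rw [List.length_cons, List.foldl_cons]
      omega
  obtain ⟨h₁, h₂, h₃⟩ := key A A hA
  refine ⟨h₁, h₂, fun hf => ?_⟩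
  have := h₃ hf
  have h₀ := List.countP_le_length (p := Arc.isViolated) (l := A)
  rw [Nat.sub_eq_zero_of_le h₀, Nat.le_zero, List.countP_eq_zero] at this
  exact this

/-! ### Constraints and circulations -/

/-- A constraint on a set of points: the number of its points in the region lies between `lower`
and `upper`. In the network it is represented by parallel arcs from `tail` to `head`. -/
structure Constraint where
  tail : Node
  head : Node
  lower : List Unit
  upper : List Unit
  region : ℚ × ℚ → Bool

/-- The arcs of a constraint. -/
def Constraint.arcs (c : Constraint) : List Arc := bundle c.tail c.head c.lower c.upper

/-- The arc of a point. -/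
def pointArc (s t : ℚ × ℚ → Node) (p : ℚ × ℚ) : Arc := ⟨s p, t p, [p], false, false⟩

/-- The network with given constraints and candidate points. -/
def network (C : List Constraint) (P : List (ℚ × ℚ)) (s t : ℚ × ℚ → Node) : List Arc :=
  C.flatMap Constraint.arcs ++ P.map (pointArc s t)

theorem sum_eq_of_nodup {ι κ M : Type} [AddCommMonoid M] {key : ι → κ} {l : List ι}
    (hl : (l.map key).Nodup) {i : ι} (hi : i ∈ l) {g : ι → M}
    (hg : ∀ j ∈ l, key j ≠ key i → g j = 0) : (l.map g).sum = g i := by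
  induction l with
  | nil => simp at hi
  | cons j l ih =>
    rw [List.map_cons, List.nodup_cons] at hl
    rw [List.map_cons, List.sum_cons]
    rcases List.mem_cons.1 hi with rfl | hi
    · rw [List.sum_eq_zero, add_zero]
      intro x hx
      obtain ⟨j, hj, rfl⟩ := List.mem_map.1 hx
      exact hg j (List.mem_cons_of_mem _ hj) fun h => hl.1 (h ▸ List.mem_map_of_mem hj)
    · rw [ih hl.2 hi fun j hj => hg j (List.mem_cons_of_mem _ hj),
        hg j List.mem_cons_self fun h => hl.1 (h ▸ List.mem_map_of_mem hi), zero_add]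

/-- The conditions that make the circulations of a network correspond to the sets of points that
satisfy the constraints: each point lies on a cycle that passes exactly through the constraints on
this point, and each constraint is singled out by a potential. -/
structure IsAdapted (C : List Constraint) (P : List (ℚ × ℚ)) (s t : ℚ × ℚ → Node) : Prop where
  cycle : ∀ p ∈ P, ∀ h : Node → ℤ,
    (C.map fun c => if c.region p = true then h c.tail - h c.head else 0).sum +
      (h (s p) - h (t p)) = 0
  potential : ∀ c ∈ C, ∃ h : Node → ℤ, h c.tail - h c.head ≠ 0 ∧
    ∀ d ∈ C, (d.tail, d.head) ≠ (c.tail, c.head) → h d.tail - h d.head = 0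
  nodup_keys : (C.map fun c => (c.tail, c.head)).Nodup
  nodup : P.Nodup
  lower_le : ∀ c ∈ C, c.lower.length ≤ c.upper.length

section network

variable {C : List Constraint} {P : List (ℚ × ℚ)} {s t : ℚ × ℚ → Node}

theorem base_of_mem_network {a : Arc} (ha : a ∈ network C P s t) : a.base = a := by
  simp only [network, Constraint.arcs, bundle, pointArc, List.mem_append, List.mem_flatMap,
    List.mem_map] at ha
  rcases ha with ⟨c, -, ⟨_, -, rfl⟩ | ⟨_, -, rfl⟩⟩ | ⟨p, -, rfl⟩ <;> rfl

theorem map_base_network : (network C P s t).map Arc.base = network C P s t :=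
  (List.map_congr_left fun _ ha => base_of_mem_network ha).trans (List.map_id' _)

theorem isCirculation_network : IsCirculation (network C P s t) := by
  intro h
  refine List.sum_eq_zero fun x hx => ?_
  obtain ⟨a, ha, rfl⟩ := List.mem_map.1 hx
  have : a.used = false := by rw [← base_of_mem_network ha]; rfl
  simp [Arc.val, this]

/-- A point set that satisfies the constraints yields a circulation: the sum of the cycles of its
points. -/
theorem IsAdapted.isFeasible (hN : IsAdapted C P s t) (F : Finset (ℚ × ℚ))
    (hF : ∀ c ∈ C, c.lower.length ≤ P.countP (fun p => decide (p ∈ F) && c.region p) ∧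
      P.countP (fun p => decide (p ∈ F) && c.region p) ≤ c.upper.length) :
    IsFeasible (network C P s t) := by
  let n : Constraint → ℕ := fun c => P.countP (fun p => decide (p ∈ F) && c.region p)
  let B₁ : Constraint → List Arc := fun c =>
    List.replicate c.lower.length ⟨c.tail, c.head, [], true, true⟩ ++
      (List.replicate (n c - c.lower.length) ⟨c.tail, c.head, [], false, true⟩ ++
        List.replicate (c.upper.length - n c) ⟨c.tail, c.head, [], false, false⟩)
  let B₂ : ℚ × ℚ → Arc := fun p => ⟨s p, t p, [p], false, decide (p ∈ F)⟩
  refine ⟨C.flatMap B₁ ++ P.map B₂, ?_, fun h => ?_, fun b hb hf => ?_⟩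
  · rw [map_base_network, network, List.map_append, List.map_flatMap, List.map_map]
    congr 1
    refine List.flatMap_congr fun c hc => ?_
    have := hF c hc
    simp only [B₁, Constraint.arcs, bundle, List.map_append, List.map_replicate, Arc.base,
      List.map_const', length_monus, List.replicate_append_replicate]
    congr 2
    have : c.lower.length ≤ n c ∧ n c ≤ c.upper.length := this
    omega
  · have h₁ : ∀ c ∈ C, ((B₁ c).map (Arc.val h)).sum = (n c : ℤ) * (h c.tail - h c.head) := by
      intro c hc
      have h₂ : c.lower.length ≤ n c := (hF c hc).1
      simp only [B₁, List.map_append, List.map_replicate, Arc.val, List.sum_append,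
        List.sum_replicate, if_true, nsmul_eq_mul, Nat.cast_sub h₂]
      simp
      ring
    have key : ∀ Q ⊆ P, (C.map fun c =>
        (Q.countP (fun p => decide (p ∈ F) && c.region p) : ℤ) * (h c.tail - h c.head)).sum +
          (Q.map fun p => (B₂ p).val h).sum = 0 := by
      intro Q hQ
      induction Q with
      | nil => simp
      | cons p Q ih =>
        have h₂ := ih fun q hq => hQ (List.mem_cons_of_mem _ hq)
        have h₃ := hN.cycle p (hQ List.mem_cons_self) h
        by_cases hp : p ∈ F
        · rw [← add_zero (0 : ℤ)]
          nth_rw 2 [← h₂]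
          rw [← h₃]
          have : (C.map fun c => ((p :: Q).countP (fun p => decide (p ∈ F) && c.region p) : ℤ) *
              (h c.tail - h c.head)) = C.map fun c =>
              (if c.region p = true then h c.tail - h c.head else 0) +
              (Q.countP (fun p => decide (p ∈ F) && c.region p) : ℤ) * (h c.tail - h c.head) := by
            refine List.map_congr_left fun c _ => ?_
            rw [List.countP_cons]
            split_ifs <;> simp_all
            ring
          rw [this, List.sum_map_add, List.map_cons, List.sum_cons]
          simp only [B₂, Arc.val, hp, decide_true, if_true]
          ring
        · simpa [B₂, Arc.val, hp, List.countP_cons] using h₂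
    have h₂ : ((C.flatMap B₁).map (Arc.val h)).sum =
        (C.map fun c => ((B₁ c).map (Arc.val h)).sum).sum := by
      rw [List.map_flatMap, List.flatMap, List.sum_flatten, List.map_map]
      rfl
    rw [List.map_append, List.sum_append, List.map_map, h₂, List.map_congr_left h₁]
    exact key P (List.Subset.refl P)
  · simp only [B₁, B₂, List.mem_append, List.mem_flatMap, List.mem_map, List.mem_replicate] at hb
    rcases hb with ⟨c, -, ⟨-, rfl⟩ | ⟨-, rfl⟩ | ⟨-, rfl⟩⟩ | ⟨p, -, rfl⟩
    · rfl
    · rfl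
    · simp at hf
    · simp at hf

theorem usedPoints_sublist {B : List Arc} (hB : B.map Arc.base = network C P s t) :
    List.Sublist (usedPoints B) P := by
  have h₁ : ∀ B : List Arc, List.Sublist (usedPoints B) ((B.map Arc.base).flatMap Arc.points) := by
    intro B
    induction B with
    | nil => exact List.Sublist.slnil
    | cons b B ih =>
      rw [usedPoints, List.flatMap_cons, ← usedPoints, List.map_cons, List.flatMap_cons]
      refine List.Sublist.append ?_ ih
      split_ifs
      · exact List.Sublist.refl _
      · exact List.nil_sublist _
  have h₂ : (network C P s t).flatMap Arc.points = P := by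
    rw [network, List.flatMap_append, List.flatMap_map]
    have : (C.flatMap Constraint.arcs).flatMap Arc.points = [] := by
      rw [List.flatMap_eq_nil_iff]
      intro a ha
      simp only [Constraint.arcs, bundle, List.mem_append, List.mem_flatMap, List.mem_map] at ha
      rcases ha with ⟨c, -, ⟨_, -, rfl⟩ | ⟨_, -, rfl⟩⟩ <;> rfl
    rw [this]
    simp [pointArc]
  simpa [hB, h₂] using h₁ B

theorem sum_map_ite_eq {ι : Type} (l : List ι) (p : ι → Bool) (x : ℤ) :
    (l.map fun i => if p i = true then x else 0).sum = x * l.countP p := by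
  induction l with
  | nil => simp
  | cons i l ih =>
    rw [List.map_cons, List.sum_cons, ih, List.countP_cons]
    split_ifs <;> push_cast <;> ring

/-- The number of arcs of a network that belong to a constraint and have a further property. -/
theorem IsAdapted.countP_network (hN : IsAdapted C P s t) {c : Constraint} (hc : c ∈ C)
    (f : Arc → Bool) :
    (network C P s t).countP (fun a =>
      a.points.isEmpty && decide ((a.tail, a.head) = (c.tail, c.head)) && f a) =
    c.arcs.countP f := by
  have h₁ : ∀ d : Constraint, ∀ a ∈ d.arcs, a.points = [] ∧ a.tail = d.tail ∧ a.head = d.head := by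
    intro d a ha
    simp only [Constraint.arcs, bundle, List.mem_append, List.mem_map] at ha
    rcases ha with ⟨_, -, rfl⟩ | ⟨_, -, rfl⟩ <;> exact ⟨rfl, rfl, rfl⟩
  rw [network, List.countP_append, List.countP_flatMap, List.countP_map]
  rw [show P.countP _ = 0 from List.countP_eq_zero.2 fun p _ => by simp [pointArc], add_zero]
  rw [sum_eq_of_nodup hN.nodup_keys hc]
  · refine List.countP_congr fun a ha => ?_
    simp [h₁ c a ha]
  · intro d _ hd
    refine List.countP_eq_zero.2 fun a ha => ?_
    obtain ⟨h₁, h₂, h₃⟩ := h₁ d a ha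
    rw [h₂, h₃]
    simp [hd]

/-- A circulation that carries flow on all forced arcs yields a point set that satisfies the
constraints: pairing the flow with the potential of a constraint shows that the flow through the
constraint equals the number of points in its region. -/
theorem IsAdapted.le_countP (hN : IsAdapted C P s t) {B : List Arc}
    (hB : B.map Arc.base = network C P s t) (hBc : IsCirculation B)
    (hBf : ∀ b ∈ B, b.forced = true → b.used = true) {c : Constraint} (hc : c ∈ C) :
    c.lower.length ≤ (usedPoints B).countP c.region ∧
      (usedPoints B).countP c.region ≤ c.upper.length := by
  obtain ⟨h, hε, hh⟩ := hN.potential c hc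
  have hp : ∀ p ∈ P, h (s p) - h (t p) =
      if c.region p = true then -(h c.tail - h c.head) else 0 := by
    intro p hp
    have h₁ := hN.cycle p hp h
    rw [sum_eq_of_nodup hN.nodup_keys hc fun d hd hdc => by simp [hh d hd hdc]] at h₁
    split_ifs at h₁ ⊢ <;> omega
  let g : Arc → Bool := fun a =>
    a.points.isEmpty && decide ((a.tail, a.head) = (c.tail, c.head)) && a.used
  have hval : ∀ b ∈ B, b.val h = (if g b = true then h c.tail - h c.head else 0) +
      -(h c.tail - h c.head) * ((if b.used = true then b.points else []).countP c.region : ℕ) := by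
    intro b hb
    have hb' : b.base ∈ network C P s t := hB ▸ List.mem_map_of_mem hb
    obtain ⟨x, y, l, f, u⟩ := b
    simp only [Arc.base, network, Constraint.arcs, bundle, pointArc, List.mem_append,
      List.mem_flatMap, List.mem_map, Arc.mk.injEq] at hb'
    cases u
    · simp [Arc.val, g]
    · rcases hb' with ⟨d, hd, ⟨_, -, rfl, rfl, rfl, -⟩ | ⟨_, -, rfl, rfl, rfl, -⟩⟩ |
        ⟨p, hpP, rfl, rfl, rfl, -⟩
      · by_cases hk : (d.tail, d.head) = (c.tail, c.head)
        · have hk' := Prod.mk.inj hk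
          simp [Arc.val, g, hk'.1, hk'.2]
        · simp only [Arc.val, if_true, hh d hd hk]
          simp [g, Prod.mk.injEq] at hk ⊢
          exact fun h₁ h₂ => absurd h₂ (hk h₁)
      · by_cases hk : (d.tail, d.head) = (c.tail, c.head)
        · have hk' := Prod.mk.inj hk
          simp [Arc.val, g, hk'.1, hk'.2]
        · simp only [Arc.val, if_true, hh d hd hk]
          simp [g, Prod.mk.injEq] at hk ⊢
          exact fun h₁ h₂ => absurd h₂ (hk h₁)
      · simp only [Arc.val, if_true, hp p hpP]
        simp [g, List.countP_cons]
  have hsum := hBc h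
  rw [List.map_congr_left hval, List.sum_map_add, sum_map_ite_eq, List.sum_map_mul_left] at hsum
  have hused : (B.map fun b =>
      (((if b.used = true then b.points else []).countP c.region : ℕ) : ℤ)).sum =
        ((usedPoints B).countP c.region : ℕ) := by
    rw [usedPoints, List.countP_flatMap, Nat.cast_list_sum, List.map_map]
    rfl
  rw [hused, neg_mul, ← sub_eq_add_neg, sub_eq_zero, mul_right_inj' hε, Nat.cast_inj] at hsum
  rw [← hsum]
  have hcount : ∀ f : Arc → Bool, (∀ a, f a.base = f a) → B.countP (fun a =>
      a.points.isEmpty && decide ((a.tail, a.head) = (c.tail, c.head)) && f a) =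
      c.arcs.countP f := by
    intro f hf
    rw [← hN.countP_network hc f, ← hB, List.countP_map]
    refine List.countP_congr fun a _ => ?_
    simp only [Function.comp_apply, hf]
    rfl
  have h₁ := hcount Arc.forced fun _ => rfl
  have h₂ := hcount (fun _ => true) fun _ => rfl
  have hlo : c.arcs.countP Arc.forced = c.lower.length := by
    simp [Constraint.arcs, bundle, List.countP_replicate]
  have hhi : c.arcs.countP (fun _ => true) = c.upper.length := by
    have := hN.lower_le c hc
    simp [Constraint.arcs, bundle, length_monus]
    omega
  rw [← hlo, ← hhi, ← h₁, ← h₂]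
  constructor
  · refine List.countP_mono_left fun b hb hb' => ?_
    simp only [Bool.and_eq_true, g] at hb' ⊢
    exact ⟨hb'.1, hBf b hb hb'.2⟩
  · refine List.countP_mono_left fun b hb hb' => ?_
    simp only [Bool.and_eq_true, g] at hb' ⊢
    exact ⟨hb'.1, trivial⟩

end network

/-! ### The constraints of a slice -/

/-- The conditions on the lines and windows of a slice, as constraints of a network. -/
def Slice.constraints (S : Slice) : List Constraint :=
  S.rows.map (fun e => ⟨root, rowNode e.1, cap S.big e.2, cap S.big e.2,
    fun p => decide (p.2 = e.1)⟩) ++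
  (S.cols.map (fun e => ⟨colNode e.1, root, cap S.big e.2, cap S.big e.2,
    fun p => decide (p.1 = e.1)⟩) ++
  S.windows.map (fun w => ⟨w.tail, w.head, w.lower S.big, w.upper S.big,
    fun p => decide (p ∈ w.points)⟩))

theorem Slice.arcs_eq (S : Slice) :
    S.arcs = network S.constraints S.points S.source S.target := by
  simp only [Slice.arcs, network, Slice.constraints, List.flatMap_append, List.flatMap_map,
    Constraint.arcs]
  rfl

theorem Slice.mem_points {S : Slice} {p : ℚ × ℚ} :
    p ∈ S.points ↔ (∃ c ∈ S.cols, c.1 = p.1) ∧ ∃ r ∈ S.rows, r.1 = p.2 := by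
  obtain ⟨x, y⟩ := p
  simp only [Slice.points, List.mem_flatMap, List.mem_map, Prod.mk.injEq]
  constructor
  · rintro ⟨c, hc, r, hr, h₁, h₂⟩
    exact ⟨⟨c, hc, h₁⟩, r, hr, h₂⟩
  · rintro ⟨⟨c, hc, h₁⟩, r, hr, h₂⟩
    exact ⟨c, hc, r, hr, h₁, h₂⟩

theorem Slice.toFinset_points (S : Slice) : S.points.toFinset = S.grid := by
  ext p
  rw [List.mem_toFinset, Slice.mem_points]
  simp [Slice.grid]

theorem Slice.nodup_points {S : Slice} (hS : S.WellFormed) : S.points.Nodup := by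
  have h : S.points = (S.cols.map Prod.fst) ×ˢ (S.rows.map Prod.fst) := by
    simp [Slice.points, SProd.sprod, List.product, List.flatMap_map, Function.comp_def]
  rw [h]
  exact hS.2.1.1.product hS.1.1

theorem Slice.length_big (S : Slice) : S.big.length = S.points.length + 1 := by
  simp [Slice.big]

/-- The slice satisfies the hypotheses of the theorem. -/
def Slice.IsOrthogonal (S : Slice) : Prop := S.WellFormed ∧ S.WindowsInLines ∧ S.WindowsDisjoint

section window

variable {w : Window}

theorem Window.anchor_mem (hw : w.points ≠ []) : w.anchor ∈ w.points := by
  unfold Window.anchor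
  cases h : w.points with
  | nil => exact absurd h hw
  | cons p l => simp

theorem Window.snd_eq (hw : w.isHorizontal = true) {p : ℚ × ℚ} (hp : p ∈ w.points) :
    p.2 = w.anchor.2 := by
  simp only [Window.isHorizontal, List.all_eq_true, decide_eq_true_eq] at hw
  exact hw p hp

end window

variable {S : Slice}

theorem Slice.IsOrthogonal.fst_eq (hS : S.IsOrthogonal) {w : Window} (hw : w ∈ S.windows)
    (h : w.isHorizontal = false) {p : ℚ × ℚ} (hp : p ∈ w.points) : p.1 = w.anchor.1 := by
  have ha := Window.anchor_mem (hS.1.2.2 w hw).1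
  rcases hS.2.1 w hw with ⟨c, hc⟩ | ⟨c, hc⟩
  · have : w.isHorizontal = true := by
      simp only [Window.isHorizontal, List.all_eq_true, decide_eq_true_eq]
      intro q hq
      rw [hc q hq, hc _ ha]
    simp [h] at this
  · rw [hc p hp, hc _ ha]

theorem Slice.IsOrthogonal.window_unique (hS : S.IsOrthogonal) {v w : Window}
    (hv : v ∈ S.windows) (hw : w ∈ S.windows) {p : ℚ × ℚ} (hpv : p ∈ v.points)
    (hpw : p ∈ w.points) : v = w := by
  by_contra hne
  have : Std.Symm fun v w : Window => List.Disjoint v.points w.points := ⟨fun _ _ h => h.symm⟩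
  exact List.Pairwise.forall hS.2.2 hv hw hne hpv hpw

theorem Slice.IsOrthogonal.nodup_anchor (hS : S.IsOrthogonal) :
    (S.windows.map Window.anchor).Nodup := by
  rw [List.Nodup, List.pairwise_map]
  refine List.Pairwise.imp_of_mem (fun {v w} hv hw h hvw => ?_) hS.2.2
  exact h (Window.anchor_mem (hS.1.2.2 v hv).1)
    (hvw ▸ Window.anchor_mem (hS.1.2.2 w hw).1)

theorem Slice.source_of_mem (hS : S.IsOrthogonal) {w : Window} (hw : w ∈ S.windows)
    (h : w.isHorizontal = true) {p : ℚ × ℚ} (hp : p ∈ w.points) :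
    S.source p = horNode w.anchor := by
  unfold Slice.source
  cases hf : S.windows.filter fun w =>
    w.isHorizontal && w.points.any fun q => decide (q = p) with
  | nil =>
    have := List.filter_eq_nil_iff.1 hf w hw
    simp [h, hp] at this
  | cons v l =>
    have hv := List.mem_filter.1 (hf ▸ List.mem_cons_self : v ∈ _)
    have hpv : p ∈ v.points := by simpa using (Bool.and_eq_true_iff.1 hv.2).2
    rw [hS.window_unique hv.1 hw hpv hp]
    rfl

theorem Slice.source_of_forall {p : ℚ × ℚ}
    (h : ∀ w ∈ S.windows, p ∈ w.points → w.isHorizontal = false) : S.source p = rowNode p.2 := by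
  unfold Slice.source
  rw [List.filter_eq_nil_iff.2]
  · rfl
  · intro w hw h'
    obtain ⟨h₁, h₂⟩ := Bool.and_eq_true_iff.1 h'
    simp [h w hw (by simpa using h₂)] at h₁

theorem Slice.target_of_mem (hS : S.IsOrthogonal) {w : Window} (hw : w ∈ S.windows)
    (h : w.isHorizontal = false) {p : ℚ × ℚ} (hp : p ∈ w.points) :
    S.target p = verNode w.anchor := by
  unfold Slice.target
  cases hf : S.windows.filter fun w =>
    !w.isHorizontal && w.points.any fun q => decide (q = p) with
  | nil =>
    have := List.filter_eq_nil_iff.1 hf w hw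
    simp [h, hp] at this
  | cons v l =>
    have hv := List.mem_filter.1 (hf ▸ List.mem_cons_self : v ∈ _)
    have hpv : p ∈ v.points := by simpa using (Bool.and_eq_true_iff.1 hv.2).2
    rw [hS.window_unique hv.1 hw hpv hp]
    rfl

theorem Slice.target_of_forall {p : ℚ × ℚ}
    (h : ∀ w ∈ S.windows, p ∈ w.points → w.isHorizontal = true) : S.target p = colNode p.1 := by
  unfold Slice.target
  rw [List.filter_eq_nil_iff.2]
  · rfl
  · intro w hw h'
    obtain ⟨h₁, h₂⟩ := Bool.and_eq_true_iff.1 h'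
    simp [h w hw (by simpa using h₂)] at h₁

/-- The flow along the window arcs that belongs to a point. -/
theorem Slice.IsOrthogonal.sum_windows (hS : S.IsOrthogonal) (p : ℚ × ℚ) (h : Node → ℤ) :
    (S.windows.map fun w => if decide (p ∈ w.points) = true then h w.tail - h w.head else 0).sum =
      (h (rowNode p.2) - h (S.source p)) + (h (S.target p) - h (colNode p.1)) := by
  by_cases hp : ∃ w ∈ S.windows, p ∈ w.points
  · obtain ⟨w, hw, hpw⟩ := hp
    have huniq : ∀ v ∈ S.windows, p ∈ v.points → v = w :=
      fun v hv hpv => hS.window_unique hv hw hpv hpw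
    rw [sum_eq_of_nodup hS.nodup_anchor hw fun v hv hvw => by
      rw [if_neg]
      simpa using fun hpv => hvw (by rw [huniq v hv hpv])]
    cases hh : w.isHorizontal
    · rw [Slice.source_of_forall fun v hv hpv => by rw [huniq v hv hpv, hh],
        Slice.target_of_mem hS hw hh hpw, hS.fst_eq hw hh hpw]
      simp [Window.tail, Window.head, hh, hpw]
    · rw [Slice.target_of_forall fun v hv hpv => by rw [huniq v hv hpv, hh],
        Slice.source_of_mem hS hw hh hpw, Window.snd_eq hh hpw]
      simp [Window.tail, Window.head, hh, hpw]
  · push Not at hp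
    rw [Slice.source_of_forall fun w hw hpw => absurd hpw (hp w hw),
      Slice.target_of_forall fun w hw hpw => absurd hpw (hp w hw), List.sum_eq_zero]
    · ring
    · intro x hx
      obtain ⟨w, hw, rfl⟩ := List.mem_map.1 hx
      simp [hp w hw]

theorem Window.lower_le_upper (U : List Unit) (w : Window) :
    (w.lower U).length ≤ (w.upper U).length := by
  unfold Window.lower Window.upper
  split_ifs <;> simp [length_cap]

theorem Slice.IsOrthogonal.isAdapted (hS : S.IsOrthogonal) :
    IsAdapted S.constraints S.points S.source S.target where
  cycle p hp h := by
    obtain ⟨⟨c, hc, hcp⟩, r, hr, hrp⟩ := Slice.mem_points.1 hp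
    simp only [Slice.constraints, List.map_append, List.map_map, List.sum_append,
      Function.comp_def]
    rw [hS.sum_windows, sum_eq_of_nodup hS.1.1.1 hr fun j _ hj => by
        rw [if_neg]
        simpa [← hrp] using hj.symm,
      sum_eq_of_nodup hS.1.2.1.1 hc fun j _ hj => by
        rw [if_neg]
        simpa [← hcp] using hj.symm]
    simp only [hrp, hcp, decide_true, if_true]
    ring
  potential c hc := by
    -- The potentials are the indicator functions of a row together with the horizontal windows in
    -- it, of a column together with the vertical windows in it, and of the node of a window.
    simp only [Slice.constraints, List.mem_append, List.mem_map] at hc ⊢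
    rcases hc with ⟨e, -, rfl⟩ | ⟨e, -, rfl⟩ | ⟨w, hw, rfl⟩
    · refine ⟨fun n => if (n.1 = 1 ∨ n.1 = 2) ∧ n.2.2 = e.1 then 1 else 0, by
        simp [root, rowNode], ?_⟩
      rintro d (⟨e', -, rfl⟩ | ⟨e', -, rfl⟩ | ⟨w, -, rfl⟩) hd
      · simpa [root, rowNode] using hd
      · simp [root, colNode]
      · cases h : w.isHorizontal <;>
          simp [Window.tail, Window.head, h, rowNode, horNode, colNode, verNode]
    · refine ⟨fun n => if (n.1 = 3 ∨ n.1 = 4) ∧ n.2.1 = e.1 then 1 else 0, by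
        simp [root, colNode], ?_⟩
      rintro d (⟨e', -, rfl⟩ | ⟨e', -, rfl⟩ | ⟨w, -, rfl⟩) hd
      · simp [root, rowNode]
      · simpa [root, colNode] using hd
      · cases h : w.isHorizontal <;>
          simp [Window.tail, Window.head, h, rowNode, horNode, colNode, verNode]
    · cases hh : w.isHorizontal
      · refine ⟨fun n => if n = verNode w.anchor then 1 else 0, by
          simp [Window.tail, Window.head, hh, verNode, colNode], ?_⟩
        rintro d (⟨e', -, rfl⟩ | ⟨e', -, rfl⟩ | ⟨v, -, rfl⟩) hd
        · simp [root, rowNode, verNode]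
        · simp [root, colNode, verNode]
        · cases h : v.isHorizontal
          · have : v.anchor ≠ w.anchor := fun h' =>
              hd (by simp [Window.tail, Window.head, h, hh, h'])
            simp [Window.tail, Window.head, h, verNode, colNode, this]
          · simp [Window.tail, Window.head, h, rowNode, horNode, verNode]
      · refine ⟨fun n => if n = horNode w.anchor then 1 else 0, by
          simp [Window.tail, Window.head, hh, horNode, rowNode], ?_⟩
        rintro d (⟨e', -, rfl⟩ | ⟨e', -, rfl⟩ | ⟨v, -, rfl⟩) hd
        · simp [root, rowNode, horNode]
        · simp [root, colNode, horNode]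
        · cases h : v.isHorizontal
          · simp [Window.tail, Window.head, h, verNode, colNode, horNode]
          · have : v.anchor ≠ w.anchor := fun h' =>
              hd (by simp [Window.tail, Window.head, h, hh, h'])
            simp [Window.tail, Window.head, h, rowNode, horNode, this]
  nodup_keys := by
    simp only [Slice.constraints, List.map_append, List.map_map, Function.comp_def]
    rw [List.nodup_append, List.nodup_append]
    refine ⟨?_, ⟨?_, ?_, ?_⟩, ?_⟩
    · have := hS.1.1.1
      rw [List.Nodup, List.pairwise_map] at this ⊢
      exact this.imp fun h => by simpa [rowNode] using h
    · have := hS.1.2.1.1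
      rw [List.Nodup, List.pairwise_map] at this ⊢
      exact this.imp fun h => by simpa [colNode] using h
    · have := hS.nodup_anchor
      rw [List.Nodup, List.pairwise_map] at this ⊢
      refine this.imp fun {v w} h => ?_
      cases hv : v.isHorizontal <;> cases hw : w.isHorizontal <;>
        simp_all [Window.tail, Window.head, rowNode, horNode, colNode, verNode]
    · simp only [List.mem_map]
      rintro _ ⟨e, -, rfl⟩ _ ⟨w, -, rfl⟩
      cases hw : w.isHorizontal <;>
        simp [Window.tail, Window.head, hw, rowNode, root, colNode, verNode]
    · simp only [List.mem_append, List.mem_map]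
      rintro _ ⟨e, -, rfl⟩ _ (⟨e', -, rfl⟩ | ⟨w, -, rfl⟩)
      · simp [root, colNode]
      · cases hw : w.isHorizontal <;>
          simp [Window.tail, Window.head, hw, rowNode, root, verNode]
  nodup := Slice.nodup_points hS.1
  lower_le c hc := by
    simp only [Slice.constraints, List.mem_append, List.mem_map] at hc
    rcases hc with ⟨e, -, rfl⟩ | ⟨e, -, rfl⟩ | ⟨w, hw, rfl⟩
    · exact le_rfl
    · exact le_rfl
    · exact w.lower_le_upper _

/-- The solutions for one moment in time are the sets of candidate points that satisfy the
constraints. Cutting off the bounds at a number larger than the number of candidate points does not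
change the constraints. -/
theorem Slice.isSolution_iff {F : Finset (ℚ × ℚ)} (hF : F ⊆ S.grid) :
    S.IsSolution F ↔ ∀ c ∈ S.constraints,
      c.lower.length ≤ (F.filter fun p => c.region p = true).card ∧
        (F.filter fun p => c.region p = true).card ≤ c.upper.length := by
  have hcard : F.card ≤ S.points.length :=
    (Finset.card_le_card (S.toFinset_points ▸ hF)).trans (List.toFinset_card_le _)
  have hlt : ∀ q : ℚ × ℚ → Prop, [DecidablePred q] → (F.filter q).card < S.big.length := by
    intro q _
    have := Finset.card_filter_le F q
    rw [S.length_big]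
    omega
  have hcap : ∀ (n : ℕ) (q : ℚ × ℚ → Prop) [DecidablePred q],
      ((cap S.big n).length ≤ (F.filter q).card ∧ (F.filter q).card ≤ (cap S.big n).length) ↔
        (F.filter q).card = n := by
    intro n q _
    have := hlt q
    rw [length_cap]
    omega
  have hwin : ∀ w : Window, F ∩ w.points.toFinset = F.filter fun p => p ∈ w.points := by
    intro w
    ext p
    simp
  simp only [Slice.IsSolution, Slice.constraints, List.forall_mem_append, List.forall_mem_map,
    decide_eq_true_eq, hcap, hwin, hF, true_and]
  refine and_congr_right' (and_congr_right' (forall₂_congr fun w _ => ?_))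
  have h₁ := hlt fun p => p ∈ w.points
  unfold Window.lower Window.upper
  cases w.rel <;> simp [Rel.Holds, length_cap] <;> omega

/-- Counting in a list without repetitions amounts to counting in a finite set. -/
theorem countP_eq_card {L : List (ℚ × ℚ)} (hL : L.Nodup) (q : ℚ × ℚ → Bool) :
    L.countP q = (L.toFinset.filter fun p => q p = true).card := by
  rw [← List.toFinset_filter, List.toFinset_card_of_nodup (hL.filter q),
    List.countP_eq_length_filter]

/-! ### Correctness of the answer -/

theorem Slice.IsOrthogonal.of_mem_solve (hS : S.IsOrthogonal) {L : List (ℚ × ℚ)}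
    (hL : L ∈ S.solve) : L.Nodup ∧ S.IsSolution L.toFinset := by
  have hN := hS.isAdapted
  obtain ⟨h₁, h₂, -⟩ := optimize_spec
    (isCirculation_network (C := S.constraints) (P := S.points) (s := S.source) (t := S.target))
  rw [map_base_network] at h₁
  rw [Slice.solve, Slice.arcs_eq] at hL
  generalize optimize (network S.constraints S.points S.source S.target) = B at h₁ h₂ hL
  split_ifs at hL with hB
  · simp at hL
  · obtain rfl := List.mem_singleton.1 hL
    have hsub := usedPoints_sublist h₁
    have hnd := hsub.nodup hN.nodup
    refine ⟨hnd, (Slice.isSolution_iff fun p hp => ?_).2 fun c hc => ?_⟩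
    · rw [← S.toFinset_points, List.mem_toFinset]
      exact hsub.subset (List.mem_toFinset.1 hp)
    · rw [← countP_eq_card hnd]
      refine hN.le_countP h₁ h₂ (fun b hb hf => ?_) hc
      by_contra hu
      exact hB (List.any_eq_true.2 ⟨b, hb, by simp [Arc.isViolated, hf, hu]⟩)

theorem Slice.IsOrthogonal.solve_ne_nil (hS : S.IsOrthogonal) {F : Finset (ℚ × ℚ)}
    (hF : S.IsSolution F) : S.solve ≠ [] := by
  have hN := hS.isAdapted
  have hfeas : IsFeasible (network S.constraints S.points S.source S.target) := by
    refine hN.isFeasible F fun c hc => ?_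
    have h := (Slice.isSolution_iff hF.1).1 hF c hc
    have hcount : S.points.countP (fun p => decide (p ∈ F) && c.region p) =
        (F.filter fun p => c.region p = true).card := by
      rw [countP_eq_card hN.nodup, S.toFinset_points]
      congr 1
      ext p
      simp only [Finset.mem_filter, Bool.and_eq_true, decide_eq_true_eq]
      exact ⟨fun h => h.2, fun h => ⟨hF.1 h.1, h⟩⟩
    rwa [hcount]
  have h := (optimize_spec isCirculation_network).2.2 hfeas
  rw [Slice.solve, Slice.arcs_eq, if_neg]
  · exact List.cons_ne_nil _ _
  · simpa using h

theorem Instance.isSolution_of_solve {I : Instance} (hI : I.IsOrthogonal)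
    {L : List (List (ℚ × ℚ))} (h : I.solve = some L) : I.IsSolution L := by
  unfold Instance.solve at h
  split_ifs at h with hall
  obtain rfl := Option.some.inj h
  clear h
  induction I with
  | nil => exact List.Forall₂.nil
  | cons S I ih =>
    rw [List.all_cons, Bool.and_eq_true] at hall
    have h₁ : ∃ F, S.solve = [F] := by
      have h₀ := hall.1
      unfold Slice.solve at h₀ ⊢
      split_ifs at h₀ ⊢
      · simp at h₀
      · exact ⟨_, rfl⟩
    obtain ⟨F, hF⟩ := h₁
    rw [List.flatMap_cons, hF]
    exact List.Forall₂.cons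
      (Slice.IsOrthogonal.of_mem_solve (hI S List.mem_cons_self) (hF ▸ List.mem_singleton_self F))
      (ih (fun T hT => hI T (List.mem_cons_of_mem _ hT)) hall.2)

theorem Instance.not_isSolution_of_solve {I : Instance} (hI : I.IsOrthogonal)
    (h : I.solve = none) : ¬ ∃ L, I.IsSolution L := by
  rintro ⟨L, hL⟩
  unfold Instance.solve at h
  split_ifs at h with hall
  refine hall ?_
  clear h hall
  induction hL with
  | nil => rfl
  | @cons S F I L hS _ ih =>
    rw [List.all_cons, ih fun T hT => hI T (List.mem_cons_of_mem _ hT), Bool.and_true]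
    have := Slice.IsOrthogonal.solve_ne_nil (hI S List.mem_cons_self) hS.2
    simpa using this

end WindowTomography

theorem theorem4p2 :
    WindowTomography.SolvableInPolyTime
      WindowTomography.encInstance WindowTomography.encSolution
      WindowTomography.Instance.IsOrthogonal WindowTomography.Instance.IsSolution := by
  obtain ⟨d, p, h⟩ := WindowTomography.PolyTime.instance_solve
  have hd : ∀ I : {I // WindowTomography.Instance.IsOrthogonal I},
      ∃ t ≤ p.eval (WindowTomography.encInstance I.1).length,
        WindowTomography.Exec d (WindowTomography.encInstance I.1, [], [])
          (WindowTomography.encAnswer WindowTomography.encSolution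
            (WindowTomography.Instance.solve I.1), [], []) t := fun I => by
    have h' := h I.1 [] ([], [])
    rw [List.append_nil, List.append_nil] at h'
    exact h'
  exact ⟨fun I => WindowTomography.Instance.solve I.1,
    fun I _ => WindowTomography.Instance.isSolution_of_solve I.2,
    fun I => WindowTomography.Instance.not_isSolution_of_solve I.2,
    d.computable p hd, fun _ => (inferInstance : Finite WindowTomography.Sym)⟩
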